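/- Let $\Lambda^1$ be the 4-dimensional real vector space with basis $\gamma_0,\dots,\gamma_3$ and Minkowski scalar product $\gamma_\mu\cdot\gamma_\nu=\mathrm{diag}(1,-1,-1,-1)$, let $\gamma^\mu$ be the reciprocal basis ($\gamma^\mu\cdot\gamma_\nu=\delta^\mu_\nu$), and let $\mathcal{C}\ell(1,3)$ be its Clifford algebra, whose elements are called multiforms. Points of Minkowski spacetime are identified with $x=x^\mu\gamma_\mu\in\Lambda^1$. Let $U\subseteq\Lambda^1$ be open and let $h$ be a smooth field on $U$ of invertible linear maps $h_x:\Lambda^1\to\Lambda^1$; put $h^{*}=(h^{-1})^{\dagger}$, where $\dagger$ is the adjoint with respect to the Minkowski scalar product. Let $D$ be the Levi-Civita connection of the metric $g(a,b)=h(a)\cdot h(b)$, put $\mathcal{D}_a n=h(D_a(h^{-1}(n)))$ for fields $n$ with values in $\Lambda^1$, and let $\Omega(a)=-\tfrac12\sum_\mu\gamma^\mu\wedge\mathcal{D}_a\gamma_\mu$ be its connection 2-form, so that $\mathcal{D}_an=a\cdot\partial n+\tfrac12(\Omega(a)n-n\Omega(a))$. For a multiform field $\varphi$ define the gauge spinor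 derivative $$\mathcal{D}^s\varphi=\sum_{\mu}h^{*}(\gamma^\mu)\left(\gamma_\mu\cdot\partial\varphi+\tfrac12\,\Omega(\gamma_\mu)\varphi\right),$$ where $a\cdot\partial$ is the directional derivative along $a$ and the products are Clifford products. Let $\psi$ be a smooth Dirac–Hestenes spinor field on $U$, i.e. a smooth field with values in the even multiforms $\Lambda^0+\Lambda^2+\Lambda^4$ (then $\mathcal{D}^s\psi$ is odd), and let $\ell(x,X,Y)$ be a real-valued function of a point $x$, an even multiform $X$ and an odd multiform $Y$ which is $C^2$ near every $(x,\psi(x),\mathcal{D}^s\psi(x))$, $x\in U$ (in particular $\ell$ may be independent of $x$). Put $\mathcal{L}=\det(h)\,\ell$. Let $\partial_\psi\ell$ and $\partial_{\mathcal{D}^s\psi}\ell$ denote the multiform derivatives of $\ell$ with respect to $X$ and $Y$ at $(x,\psi(x),\mathcal{D}^s\psi(x))$, that is $\sum_I\gamma^I\,(d\ell)(\gamma_I)$, where $d\ell$ is the differential of $\ell$ in the variable concerned, $I=\{i_1<\dots<i_k\}$ runs over the index sets with $k$ even, respectively odd, $\gamma_I=\gamma_{i_1}\cdots\gamma_{i_k}$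 and $\gamma^I=\gamma^{i_1}\cdots\gamma^{i_k}$. Suppose that the action is stationary at $\psi$, in the sense that $$\int_U\left.\frac{d}{d\lambda}\,\mathcal{L}\bigl(x,\psi+\lambda\eta,\mathcal{D}^s\psi+\lambda\mathcal{D}^s\eta\bigr)\right|_{\lambda=0}d^4x=0$$ for all smooth compactly supported fields $\eta$ on $\Lambda^1$ with values in the even multiforms such that $\eta=0$ on $\partial U$. Then on $U$ $$\partial_\psi\ell(x,\psi,\mathcal{D}^s\psi)-\mathcal{D}^s\bigl(\partial_{\mathcal{D}^s\psi}\ell(x,\psi,\mathcal{D}^s\psi)\bigr)=0 .$$ -/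

import Mathlib

open MeasureTheory
open scoped ContDiff

noncomputable section

namespace GaugeSpinor

/-! ### Minkowski space and the spacetime algebra -/

/-- The Minkowski vector space of 1-forms, in coordinates with respect to the orthonormal basis
`γ_μ`.  A point of spacetime is identified with its position form `x = x^μ γ_μ`, so this is also
spacetime itself, and `d⁴x` is Lebesgue measure. -/
abbrev Form1 : Type := Fin 4 → ℝ

/-- The diagonal `(1, -1, -1, -1)` of the Minkowski metric. -/
def sig : Fin 4 → ℝ := ![1, -1, -1, -1]

/-- The scalar product `a · b` of 1-forms. -/
def mdot (a b : Form1) : ℝ := ∑ μ, sig μ * a μ * b μ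

/-- The quadratic form `a ↦ a · a`. -/
def minkQ : QuadraticForm ℝ Form1 := QuadraticMap.weightedSumSquares ℝ sig

/-- The basis 1-form `γ_μ`. -/
def lo (μ : Fin 4) : Form1 := Pi.single μ 1

/-- The reciprocal basis 1-form `γ^μ`, so that `γ^μ · γ_ν = δ^μ_ν`. -/
def up (μ : Fin 4) : Form1 := sig μ • lo μ

/-- The spacetime algebra `Cℓ(1,3)` (multiforms with the Clifford product). -/
abbrev STA : Type := CliffordAlgebra minkQ

/-- The inclusion of 1-forms in the spacetime algebra. -/
abbrev vec (a : Form1) : STA := CliffordAlgebra.ι minkQ a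

/-- The components of a multiform in the basis of exterior products of the `γ_μ`. -/
def components : STA ≃ₗ[ℝ] (Finset (Fin 4) → ℝ) :=
  (CliffordAlgebra.equivExterior minkQ).trans (Pi.basisFun ℝ (Fin 4)).ExteriorAlgebra.equivFun

/-- The largest absolute value of a component as a norm.  The space is finite-dimensional, so
smoothness and derivatives of multiform fields do not depend on the choice of the norm. -/
instance instNormedAddCommGroupSTA : NormedAddCommGroup STA :=
  NormedAddCommGroup.induced STA (Finset (Fin 4) → ℝ) components components.injective

instance instNormedSpaceSTA : NormedSpace ℝ STA :=
  NormedSpace.induced ℝ STA (Finset (Fin 4) → ℝ) components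

/-- The multiforms of even grade, `Λ⁰ + Λ² + Λ⁴`. -/
abbrev evenPart : Submodule ℝ STA := CliffordAlgebra.evenOdd minkQ 0

/-- The exterior product `a ∧ b` of two 1-forms, as an element of the spacetime algebra. -/
def wedge (a b : Form1) : STA := (1 / 2 : ℝ) • (vec a * vec b - vec b * vec a)

/-! ### The gauge metric extensor and its connection -/

/-- The adjoint `t†` of a (1,1)-extensor with respect to the Minkowski scalar product:
`t†(a) · b = a · t(b)`. -/
def adj (t : Form1 →L[ℝ] Form1) (a : Form1) : Form1 := ∑ μ, mdot a (t (lo μ)) • up μ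

/-- `h^* = (h⁻¹)†`. -/
def hstar (h : Form1 → Form1 →L[ℝ] Form1) (x a : Form1) : Form1 := adj (h x).inverse a

/-- The metric `g = h†h`, i.e. `g_x(a, b) = h_x(a) · h_x(b)`. -/
def metric (h : Form1 → Form1 →L[ℝ] Form1) (x a b : Form1) : ℝ := mdot (h x a) (h x b)

/-- The Christoffel symbols of the first kind of `g`: for constant `a, b, c`,
`½ (a·∂ g(b,c) + b·∂ g(a,c) - c·∂ g(a,b))`. -/
def christoffelLower (h : Form1 → Form1 →L[ℝ] Form1) (x a b c : Form1) : ℝ :=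
  (1 / 2 : ℝ) * (fderiv ℝ (fun y => metric h y b c) x a + fderiv ℝ (fun y => metric h y a c) x b
    - fderiv ℝ (fun y => metric h y a b) x c)

/-- The Christoffel symbols of the second kind, obtained by raising the last index with
`g⁻¹ = h⁻¹ h^*`. -/
def christoffel (h : Form1 → Form1 →L[ℝ] Form1) (x a b : Form1) : Form1 :=
  ∑ μ, christoffelLower h x a b (lo μ) • (h x).inverse (hstar h x (up μ))

/-- The Levi-Civita directional covariant derivative `D_a v` of the metric `g = h†h`. -/
def leviCivita (h : Form1 → Form1 →L[ℝ] Form1) (a : Form1) (v : Form1 → Form1) (x : Form1) :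
    Form1 :=
  fderiv ℝ v x a + christoffel h x a (v x)

/-- The gauge covariant derivative of a 1-form field, `𝒟_a n = h(D_a (h⁻¹(n)))`. -/
def gaugeDeriv (h : Form1 → Form1 →L[ℝ] Form1) (a : Form1) (n : Form1 → Form1) (x : Form1) :
    Form1 :=
  h x (leviCivita h a (fun y => (h y).inverse (n y)) x)

/-- The connection extensor `Ω_x(a) = -½ ∂_n ∧ 𝒟_a n = -½ γ^μ ∧ 𝒟_a γ_μ`, a 2-form.  It is
the one for which `𝒟_a n = a·∂ n + Ω(a) × n`. -/
def Omega (h : Form1 → Form1 →L[ℝ] Form1) (x a : Form1) : STA :=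
  -(1 / 2 : ℝ) • ∑ μ, wedge (up μ) (gaugeDeriv h a (fun _ => lo μ) x)

/-- The directional spinor derivative `𝒟^s_a ψ = a·∂ψ + ½ Ω(a) ψ`. -/
def spinorDirDeriv (h : Form1 → Form1 →L[ℝ] Form1) (a : Form1) (ψ : Form1 → STA) (x : Form1) :
    STA :=
  fderiv ℝ ψ x a + (1 / 2 : ℝ) • (Omega h x a * ψ x)

/-- The gauge spinor derivative `𝒟^s ψ = h^*(∂_a) 𝒟^s_a ψ = h^*(γ^μ) 𝒟^s_{γ_μ} ψ`. -/
def spinorDeriv (h : Form1 → Form1 →L[ℝ] Form1) (ψ : Form1 → STA) (x : Form1) : STA :=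
  ∑ μ, vec (hstar h x (up μ)) * spinorDirDeriv h (lo μ) ψ x

/-! ### Multiform derivatives -/

/-- The basis multiform `γ_I = γ_{i₁} ⋯ γ_{i_k}` for `I = {i₁ < ⋯ < i_k}`. -/
def blade (I : Finset (Fin 4)) : STA := ((I.sort (· ≤ ·)).map fun μ => vec (lo μ)).prod

/-- The reciprocal basis multiform `γ^I = γ^{i₁} ⋯ γ^{i_k}`; with the scalar product
`X · Y = ⟨X Ỹ⟩₀` one has `γ^I · γ_J = δ^I_J`. -/
def recBlade (I : Finset (Fin 4)) : STA := ((I.sort (· ≤ ·)).map fun μ => vec (up μ)).prod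

/-- The multiform derivative `∂_X f = ∑_I γ^I (γ_I · ∂_X) f`, where `(A · ∂_X) f` is the derivative
of `f` in the direction `A`, with respect to a variable `X` whose grades are even. -/
def gradEven (f : STA → ℝ) (X : STA) : STA :=
  ∑ I with Even I.card, fderiv ℝ f X (blade I) • recBlade I

/-- The multiform derivative `∂_Y f` with respect to a variable `Y` whose grades are odd. -/
def gradOdd (f : STA → ℝ) (Y : STA) : STA :=
  ∑ I with Odd I.card, fderiv ℝ f Y (blade I) • recBlade I

/-! ### The variational principle -/

/-- The Lagrangian `𝓛 = det(h) ℓ`.  The function `ℓ` may depend explicitly on the spacetime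
point (through external fields). -/
def lagrangian (h : Form1 → Form1 →L[ℝ] Form1) (l : Form1 × STA × STA → ℝ) (x : Form1)
    (X Y : STA) : ℝ :=
  (h x).det * l (x, X, Y)

/-- The variation `δ_ψ 𝓛 = d/dt 𝓛(ψ + t η, 𝒟^sψ + t 𝒟^sη)` at `t = 0`. -/
def variation (h : Form1 → Form1 →L[ℝ] Form1) (l : Form1 × STA × STA → ℝ)
    (ψ η : Form1 → STA) (x : Form1) : ℝ :=
  deriv (fun t : ℝ =>
    lagrangian h l x (ψ x + t • η x) (spinorDeriv h ψ x + t • spinorDeriv h η x)) 0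

/-- The condition of stationary action on `U`: `∫_U δ_ψ 𝓛 d⁴x = 0` for all smooth even fields `η`
that vanish on `∂U`.  The compact support of `η` is no restriction when `U` is bounded; when `U`
is unbounded it makes the condition weaker. -/
def StationaryAction (U : Set Form1) (h : Form1 → Form1 →L[ℝ] Form1)
    (l : Form1 × STA × STA → ℝ) (ψ : Form1 → STA) : Prop :=
  ∀ η : Form1 → STA, ContDiff ℝ ∞ η → HasCompactSupport η → (∀ x, η x ∈ evenPart) →
    (∀ x ∈ frontier U, η x = 0) → ∫ x in U, variation h l ψ η x = 0

end GaugeSpinor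

end

noncomputable section

namespace GaugeSpinor

/-! ### The trace form of the spacetime algebra -/

/-! Write ⟨·⟩₀ for the scalar part, realised as the normalised trace of left multiplication. On
multiforms of one fixed parity the form ⟨X̃ Y⟩₀ makes the γ^I and γ_I dual bases, so the multiform
derivatives represent the partial differentials of ℓ. For this form left multiplication by a 1-form
is self-adjoint and left multiplication by the 2-form Ω(a) is skew (`pairCLM_vec_mul`,
`pairCLM_Omega_mul`).

Put P = ∂_{𝒟^sψ}ℓ and test stationarity with η = φ γ_J, where φ is a scalar test function supported
in U and |J| is even. The variation becomes Fφ + ∑ G^μ ∂_μφ with G^μ = det(h) ⟨(h^*(γ^μ)P)~ γ_J⟩₀,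
so F = ∑ ∂_μG^μ by `eq_sum_fderiv_of_integral_eq_zero`.

The geometric input is the derivative of the weight det(h) h^*(γ^μ) in this divergence. Metric
compatibility makes the connection skew, and the contracted Christoffel symbols are the logarithmic
derivative of det h; together they give `sum_fderiv_det_smul_hstar`. By `commutator_Omega` the
derivative of the weight is then a sum of commutators ½[Ω(γ_μ), h^*(γ^μ)], up to the factor -det(h).
One term of each commutator completes ∂P to 𝒟^sP; the other, moved onto γ_J by skewness, is the
Ω-term of F (`sum_fderiv_pairCLM`). Cancelling it and det h leaves the Euler–Lagrange equation
paired with γ_J, and the even γ_J suffice to detect an even multiform. -/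

instance instFiniteDimensionalSTA : FiniteDimensional ℝ STA :=
  FiniteDimensional.of_injective (components : STA →ₗ[ℝ] (Finset (Fin 4) → ℝ))
    components.injective

lemma sig_mul_self (μ : Fin 4) : sig μ * sig μ = 1 := by
  fin_cases μ <;> simp [sig]

lemma minkQ_apply (a : Form1) : minkQ a = mdot a a := by
  simp only [minkQ, mdot, QuadraticMap.weightedSumSquares_apply, smul_eq_mul, mul_assoc]

lemma mdot_comm (a b : Form1) : mdot a b = mdot b a := by
  simp only [mdot, mul_right_comm]

lemma mdot_add_left (a b c : Form1) : mdot (a + b) c = mdot a c + mdot b c := by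
  simp only [mdot, Pi.add_apply, ← Finset.sum_add_distrib]
  exact Finset.sum_congr rfl fun _ _ => by ring

lemma mdot_smul_left (r : ℝ) (a c : Form1) : mdot (r • a) c = r * mdot a c := by
  simp only [mdot, Pi.smul_apply, smul_eq_mul, Finset.mul_sum]
  exact Finset.sum_congr rfl fun _ _ => by ring

/-- The Minkowski scalar product as a bilinear map. -/
def mdotBilin : Form1 →ₗ[ℝ] Form1 →ₗ[ℝ] ℝ :=
  LinearMap.mk₂ ℝ mdot mdot_add_left mdot_smul_left
    (fun a b c => by rw [mdot_comm, mdot_add_left, mdot_comm b, mdot_comm c])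
    (fun r a b => by rw [mdot_comm, mdot_smul_left, mdot_comm b, smul_eq_mul])

lemma mdotBilin_apply (a b : Form1) : mdotBilin a b = mdot a b := rfl

lemma mdot_lo_lo (μ ν : Fin 4) : mdot (lo μ) (lo ν) = if μ = ν then sig μ else 0 := by
  simp only [mdot, lo, Pi.single_apply, mul_ite, mul_one, mul_zero, Finset.sum_ite_eq',
    Finset.mem_univ, if_true]
  exact ite_congr (propext eq_comm) (fun h => by rw [h]) fun _ => rfl

lemma vec_mul_vec_add_swap (a b : Form1) :
    vec a * vec b + vec b * vec a = algebraMap ℝ STA (2 * mdot a b) := by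
  have h : QuadraticMap.polar minkQ a b = 2 * mdot a b := by
    simp only [QuadraticMap.polar, minkQ_apply, ← mdotBilin_apply, map_add, LinearMap.add_apply]
    rw [mdotBilin_apply b a, mdot_comm b a, ← mdotBilin_apply]
    ring
  rw [← h]
  exact CliffordAlgebra.ι_mul_ι_add_swap a b

lemma vec_lo_mul_self (μ : Fin 4) : vec (lo μ) * vec (lo μ) = algebraMap ℝ STA (sig μ) := by
  rw [vec, CliffordAlgebra.ι_sq_scalar, minkQ_apply, mdot_lo_lo, if_pos rfl]

lemma vec_lo_mul_of_ne {μ ν : Fin 4} (h : μ ≠ ν) :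
    vec (lo μ) * vec (lo ν) = -(vec (lo ν) * vec (lo μ)) := by
  have := vec_mul_vec_add_swap (lo μ) (lo ν)
  rw [mdot_lo_lo, if_neg h, mul_zero, map_zero] at this
  exact eq_neg_of_add_eq_zero_left this

lemma vec_up (μ : Fin 4) : vec (up μ) = sig μ • vec (lo μ) := by
  simp only [up, vec, map_smul]

lemma vec_up_mul_vec_lo (μ : Fin 4) : vec (up μ) * vec (lo μ) = 1 := by
  rw [vec_up, smul_mul_assoc, vec_lo_mul_self, Algebra.smul_def, ← map_mul, sig_mul_self, map_one]

lemma vec_lo_mul_vec_up (μ : Fin 4) : vec (lo μ) * vec (up μ) = 1 := by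
  rw [vec_up, mul_smul_comm, vec_lo_mul_self, Algebra.smul_def, ← map_mul, sig_mul_self, map_one]

/-- The normalised trace of left multiplication: the scalar part of a multiform. -/
def scalarPart : STA →ₗ[ℝ] ℝ :=
  (Module.finrank ℝ STA : ℝ)⁻¹ • (LinearMap.trace ℝ STA ∘ₗ (LinearMap.mul ℝ STA))

lemma scalarPart_apply (X : STA) :
    scalarPart X = (Module.finrank ℝ STA : ℝ)⁻¹ * LinearMap.trace ℝ STA (LinearMap.mulLeft ℝ X) :=
  rfl

lemma scalarPart_mul_comm (X Y : STA) : scalarPart (X * Y) = scalarPart (Y * X) := by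
  rw [scalarPart_apply, scalarPart_apply, LinearMap.mulLeft_mul, LinearMap.mulLeft_mul]
  congr 1
  exact LinearMap.trace_mul_comm ℝ _ _

lemma scalarPart_one : scalarPart 1 = 1 := by
  rw [scalarPart_apply, LinearMap.mulLeft_one, LinearMap.trace_id]
  exact inv_mul_cancel₀ (Nat.cast_ne_zero.2 Module.finrank_pos.ne')

/-- A multiform that anticommutes with some `γ_μ` has no scalar part. -/
lemma scalarPart_eq_zero_of_anticommute {X : STA} {μ : Fin 4}
    (h : vec (lo μ) * X = -(X * vec (lo μ))) : scalarPart X = 0 := by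
  -- Conjugation by γ_μ preserves the trace but reverses the sign of X.
  have h1 : scalarPart X = -scalarPart X := by
    calc scalarPart X = scalarPart (vec (up μ) * (vec (lo μ) * X)) := by
          rw [← mul_assoc, vec_up_mul_vec_lo, one_mul]
      _ = scalarPart (-(X * (vec (lo μ) * vec (up μ)))) := by
          rw [scalarPart_mul_comm, h, neg_mul, mul_assoc]
      _ = -scalarPart X := by rw [vec_lo_mul_vec_up, mul_one, map_neg]
  linarith

/-- The product `γ_{i₁} ⋯ γ_{i_k}` over a list of indices. -/
def loProd (L : List (Fin 4)) : STA := (L.map fun μ => vec (lo μ)).prod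

/-- The product `γ^{i₁} ⋯ γ^{i_k}` over a list of indices. -/
def upProd (L : List (Fin 4)) : STA := (L.map fun μ => vec (up μ)).prod

lemma loProd_cons (μ : Fin 4) (L : List (Fin 4)) : loProd (μ :: L) = vec (lo μ) * loProd L := by
  simp [loProd]

lemma upProd_cons (μ : Fin 4) (L : List (Fin 4)) : upProd (μ :: L) = vec (up μ) * upProd L := by
  simp [upProd]

/-- The scalar is a product of signs; its square being 1 allows the passage in both directions. -/
lemma exists_upProd_eq_smul (L : List (Fin 4)) : ∃ c : ℝ, c * c = 1 ∧ upProd L = c • loProd L := by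
  induction L with
  | nil => exact ⟨1, by simp, by simp [upProd, loProd]⟩
  | cons μ L ih =>
    obtain ⟨c, hc1, hc⟩ := ih
    refine ⟨sig μ * c, by rw [mul_mul_mul_comm, sig_mul_self, hc1, one_mul], ?_⟩
    rw [upProd_cons, loProd_cons, hc, vec_up, smul_mul_assoc, mul_smul_comm, smul_smul]

/-- After reversion the two head factors γ^μ and γ_μ meet in the middle and cancel. -/
lemma reverse_upProd_mul_loProd (L : List (Fin 4)) :
    CliffordAlgebra.reverse (upProd L) * loProd L = 1 := by
  induction L with
  | nil => simp [upProd, loProd]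
  | cons μ L ih =>
    rw [upProd_cons, loProd_cons, CliffordAlgebra.reverse.map_mul, CliffordAlgebra.reverse_ι,
      mul_assoc, ← mul_assoc (vec (up μ)), vec_up_mul_vec_lo, one_mul, ih]

/-- Each factor other than γ_μ contributes a sign, which gives the exponent length minus count; the
sum has the same parity and avoids truncated subtraction. -/
lemma vec_lo_mul_loProd (μ : Fin 4) (L : List (Fin 4)) :
    vec (lo μ) * loProd L = (-1 : ℝ) ^ (L.length + L.count μ) • (loProd L * vec (lo μ)) := by
  induction L with
  | nil => simp [loProd]
  | cons ν L ih =>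
    rw [loProd_cons, List.length_cons]
    by_cases h : ν = μ
    · subst h
      rw [List.count_cons_self, mul_assoc, ih, mul_smul_comm,
        show L.length + 1 + (List.count ν L + 1) = L.length + List.count ν L + 2 by ring, pow_add _ _ 2,
        neg_one_sq, mul_one]
    · rw [List.count_cons_of_ne h, ← mul_assoc, vec_lo_mul_of_ne (Ne.symm h), neg_mul, mul_assoc,
        ih, mul_smul_comm, ← mul_assoc, add_right_comm, pow_succ, mul_neg_one, neg_smul]

lemma vec_lo_mul_reverse_upProd (μ : Fin 4) (L : List (Fin 4)) :
    vec (lo μ) * CliffordAlgebra.reverse (upProd L)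
      = (-1 : ℝ) ^ (L.length + L.count μ) • (CliffordAlgebra.reverse (upProd L) * vec (lo μ)) := by
  obtain ⟨c, -, hc⟩ := exists_upProd_eq_smul L
  have h := congrArg CliffordAlgebra.reverse (vec_lo_mul_loProd μ L)
  rw [map_smul, CliffordAlgebra.reverse.map_mul, CliffordAlgebra.reverse.map_mul,
    CliffordAlgebra.reverse_ι] at h
  rw [hc, map_smul, mul_smul_comm, smul_mul_assoc, h, smul_comm c, smul_smul, ← mul_pow]
  simp

/-- The Clifford product of reciprocal basis multiforms has scalar part `δ^I_J`, for index sets of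
the same parity. -/
lemma scalarPart_reverse_recBlade_mul_blade {I J : Finset (Fin 4)} (hIJ : Even (I.card + J.card)) :
    scalarPart (CliffordAlgebra.reverse (recBlade I) * blade J) = if I = J then 1 else 0 := by
  change scalarPart (CliffordAlgebra.reverse (upProd (I.sort (· ≤ ·))) * loProd (J.sort (· ≤ ·))) = _
  split_ifs with h
  · rw [h, reverse_upProd_mul_loProd, scalarPart_one]
  -- For an index in exactly one of I and J, equal parity of the cardinalities makes the total sign
  -- exponent odd, so γ_μ anticommutes with the product.
  · obtain ⟨μ, hμ⟩ : ∃ μ, ¬(μ ∈ I ↔ μ ∈ J) := by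
      by_contra! hc
      exact h (Finset.ext hc)
    apply scalarPart_eq_zero_of_anticommute (μ := μ)
    rw [← mul_assoc, vec_lo_mul_reverse_upProd, smul_mul_assoc, mul_assoc, vec_lo_mul_loProd,
      mul_smul_comm, smul_smul, ← mul_assoc, ← pow_add]
    have hc : ∀ K : Finset (Fin 4), (K.sort (· ≤ ·)).count μ = if μ ∈ K then 1 else 0 := by
      intro K
      rw [List.Nodup.count (Finset.sort_nodup K _)]
      simp
    rw [hc, hc, Finset.length_sort, Finset.length_sort]
    have : Odd (I.card + (if μ ∈ I then 1 else 0) + (J.card + if μ ∈ J then 1 else 0)) := by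
      rw [add_add_add_comm]
      apply hIJ.add_odd
      by_cases h1 : μ ∈ I <;> by_cases h2 : μ ∈ J <;> simp_all
    rw [this.neg_one_pow, neg_one_smul]

/-! ### Basis multiforms span the even and the odd multiforms -/

/-- One step of insertion sort: γ_μ anticommutes past smaller indices until it finds its place or
cancels against an equal factor. The membership clause is what keeps the list sorted when a smaller
head is put back in front. -/
lemma exists_vec_lo_mul_loProd_eq_smul (μ : Fin 4) (L : List (Fin 4)) (hL : L.SortedLT) :
    ∃ (c : ℝ) (L' : List (Fin 4)), L'.SortedLT ∧ (∀ ν ∈ L', ν = μ ∨ ν ∈ L) ∧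
      (L'.length : ZMod 2) = L.length + 1 ∧ vec (lo μ) * loProd L = c • loProd L' := by
  induction L with
  | nil => exact ⟨1, [μ], (List.pairwise_singleton _ μ).sortedLT, by simp, by simp, by simp [loProd]⟩
  | cons ν L ih =>
    have hL' := hL
    rw [List.sortedLT_iff_pairwise, List.pairwise_cons] at hL'
    rcases lt_trichotomy μ ν with h | h | h
    · refine ⟨1, μ :: ν :: L, ?_, by simp, by simp, by rw [one_smul, loProd_cons μ]⟩
      rw [List.sortedLT_iff_pairwise, List.pairwise_cons]
      refine ⟨fun κ hκ => ?_, hL.pairwise⟩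
      rcases List.mem_cons.1 hκ with rfl | hκ
      · exact h
      · exact h.trans (hL'.1 κ hκ)
    · subst h
      refine ⟨sig μ, L, hL'.2.sortedLT, fun κ hκ => by simp [hκ], ?_, ?_⟩
      · rw [List.length_cons, Nat.cast_succ, add_assoc, CharTwo.add_self_eq_zero, add_zero]
      · rw [loProd_cons, ← mul_assoc, vec_lo_mul_self, Algebra.smul_def]
    · obtain ⟨c, L', h1, h2, h3, h4⟩ := ih hL'.2.sortedLT
      refine ⟨-c, ν :: L', ?_, ?_, ?_, ?_⟩
      · rw [List.sortedLT_iff_pairwise, List.pairwise_cons]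
        refine ⟨fun κ hκ => ?_, h1.pairwise⟩
        rcases h2 κ hκ with rfl | hκ
        · exact h
        · exact hL'.1 κ hκ
      · intro κ hκ
        rcases List.mem_cons.1 hκ with rfl | hκ
        · simp
        · rcases h2 κ hκ with rfl | hκ <;> simp [*]
      · rw [List.length_cons, List.length_cons, Nat.cast_succ, Nat.cast_succ, h3]
      · rw [loProd_cons, loProd_cons, ← mul_assoc, vec_lo_mul_of_ne h.ne', neg_mul, mul_assoc, h4,
          mul_smul_comm, neg_smul]

/-- The span of the basis multiforms `γ_I` with `|I|` of parity `n`. -/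
def bladeSpan (n : ZMod 2) : Submodule ℝ STA :=
  Submodule.span ℝ (blade '' {I | (I.card : ZMod 2) = n})

lemma loProd_mem_bladeSpan {L : List (Fin 4)} (hL : L.SortedLT) : loProd L ∈ bladeSpan L.length := by
  apply Submodule.subset_span
  have hn : L.Nodup := hL.nodup
  refine ⟨L.toFinset, by simp [List.toFinset_card_of_nodup hn], ?_⟩
  rw [blade, (List.toFinset_sort (r := (· ≤ ·)) hn).2 (hL.pairwise.imp le_of_lt)]
  rfl

lemma vec_eq_sum (a : Form1) : vec a = ∑ μ, a μ • vec (lo μ) := by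
  conv_lhs => rw [pi_eq_sum_univ' a]
  simp only [vec, map_sum, map_smul, lo]

lemma vec_mul_mem_bladeSpan {n : ZMod 2} (a : Form1) {X : STA} (hX : X ∈ bladeSpan n) :
    vec a * X ∈ bladeSpan (n + 1) := by
  rw [bladeSpan] at hX
  induction hX using Submodule.span_induction with
  | mem X hX =>
    obtain ⟨I, hI, rfl⟩ := hX
    rw [vec_eq_sum, Finset.sum_mul]
    refine Submodule.sum_mem _ fun μ _ => ?_
    obtain ⟨c, L', h1, -, h3, h4⟩ :=
      exists_vec_lo_mul_loProd_eq_smul μ (I.sort (· ≤ ·)) (Finset.sortedLT_sort I)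
    rw [smul_mul_assoc]
    change a μ • (vec (lo μ) * loProd (I.sort (· ≤ ·))) ∈ _
    rw [h4]
    refine Submodule.smul_mem _ _ (Submodule.smul_mem _ _ ?_)
    have := loProd_mem_bladeSpan h1
    rwa [h3, Finset.length_sort, show (I.card : ZMod 2) = n from hI] at this
  | zero => rw [mul_zero]; exact Submodule.zero_mem _
  | add X Y _ _ hX hY => rw [mul_add]; exact Submodule.add_mem _ hX hY
  | smul r X _ hX => rw [mul_smul_comm]; exact Submodule.smul_mem _ _ hX

lemma one_mem_bladeSpan : (1 : STA) ∈ bladeSpan 0 := by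
  have := loProd_mem_bladeSpan (L := []) List.Pairwise.nil.sortedLT
  simpa [loProd] using this

/-- The parity-n part is generated from scalars or 1-forms by multiplying with pairs of 1-forms, and
two such multiplications return to the same span. -/
lemma evenOdd_le_bladeSpan (n : ZMod 2) : CliffordAlgebra.evenOdd minkQ n ≤ bladeSpan n := by
  have key : n = 0 ∨ n = 1 := by decide +revert
  intro X hX
  have hvec : ∀ a b : Form1, ∀ X ∈ bladeSpan n, vec a * vec b * X ∈ bladeSpan n := by
    intro a b X hX
    have := vec_mul_mem_bladeSpan a (vec_mul_mem_bladeSpan b hX)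
    rwa [add_assoc, CharTwo.add_self_eq_zero, add_zero, ← mul_assoc] at this
  induction X, hX using CliffordAlgebra.evenOdd_induction with
  | range_ι_pow v h =>
    rcases key with rfl | rfl
    · simp only [ZMod.val_zero, pow_zero] at h
      obtain ⟨r, rfl⟩ := Submodule.mem_one.1 h
      rw [Algebra.algebraMap_eq_smul_one]
      exact Submodule.smul_mem _ _ one_mem_bladeSpan
    · rw [ZMod.val_one, pow_one] at h
      obtain ⟨a, rfl⟩ := h
      simpa using vec_mul_mem_bladeSpan a one_mem_bladeSpan
  | add X Y _ _ hX hY => exact Submodule.add_mem _ hX hY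
  | ι_mul_ι_mul a b X _ hX => exact hvec a b X hX

lemma listProd_vec_mem_evenOdd (L : List (Fin 4)) (f : Fin 4 → Form1) :
    (L.map fun μ => vec (f μ)).prod ∈ CliffordAlgebra.evenOdd minkQ L.length := by
  induction L with
  | nil => simpa using CliffordAlgebra.one_le_evenOdd_zero minkQ (Submodule.one_le.1 le_rfl)
  | cons μ L ih =>
    rw [List.map_cons, List.prod_cons, List.length_cons, Nat.cast_succ, add_comm]
    exact SetLike.mul_mem_graded (CliffordAlgebra.ι_mem_evenOdd_one _ _) ih

lemma blade_mem_evenOdd (I : Finset (Fin 4)) : blade I ∈ CliffordAlgebra.evenOdd minkQ I.card := by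
  have := listProd_vec_mem_evenOdd (I.sort (· ≤ ·)) lo
  rwa [Finset.length_sort] at this

lemma recBlade_mem_evenOdd (I : Finset (Fin 4)) :
    recBlade I ∈ CliffordAlgebra.evenOdd minkQ I.card := by
  have := listProd_vec_mem_evenOdd (I.sort (· ≤ ·)) up
  rwa [Finset.length_sort] at this

lemma even_card_add_card {I J : Finset (Fin 4)} {n : ZMod 2} (hI : (I.card : ZMod 2) = n)
    (hJ : (J.card : ZMod 2) = n) : Even (I.card + J.card) := by
  rw [← ZMod.natCast_eq_zero_iff_even, Nat.cast_add, hI, hJ, CharTwo.add_self_eq_zero]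

/-- A linear form `f` on the multiforms of parity `n` is represented, in the trace form, by
`∑_I f(γ_I) γ^I`. -/
lemma scalarPart_reverse_sum_mul {n : ZMod 2} (f : STA →ₗ[ℝ] ℝ) {X : STA}
    (hX : X ∈ CliffordAlgebra.evenOdd minkQ n) :
    scalarPart (CliffordAlgebra.reverse
      (∑ I : Finset (Fin 4) with (I.card : ZMod 2) = n, f (blade I) • recBlade I) * X) = f X := by
  have hX' := evenOdd_le_bladeSpan n hX
  rw [bladeSpan] at hX'
  clear hX
  induction hX' using Submodule.span_induction with
  | mem X hX =>
    obtain ⟨J, hJ, rfl⟩ := hX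
    have hJ' : (J.card : ZMod 2) = n := hJ
    simp only [map_sum, map_smul, Finset.sum_mul, smul_mul_assoc, smul_eq_mul]
    rw [Finset.sum_congr rfl (g := fun I => if I = J then f (blade J) else 0)]
    · simp [hJ']
    · intro I hI
      rw [scalarPart_reverse_recBlade_mul_blade (even_card_add_card (Finset.mem_filter.1 hI).2 hJ')]
      split_ifs with h <;> simp [h]
  | zero => simp
  | add X Y _ _ hX hY => rw [mul_add, map_add, map_add, hX, hY]
  | smul r X _ hX => rw [mul_smul_comm, map_smul, map_smul, hX]

lemma blade_eq_smul_recBlade (I : Finset (Fin 4)) : ∃ c : ℝ, blade I = c • recBlade I := by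
  obtain ⟨c, hc1, hc⟩ := exists_upProd_eq_smul (I.sort (· ≤ ·))
  refine ⟨c, ?_⟩
  change loProd _ = c • upProd _
  rw [hc, smul_smul, hc1, one_smul]

/-- The expansion of a multiform of parity `n` in the reciprocal basis multiforms. -/
lemma eq_sum_scalarPart_smul_recBlade {n : ZMod 2} {Z : STA}
    (hZ : Z ∈ CliffordAlgebra.evenOdd minkQ n) :
    Z = ∑ J : Finset (Fin 4) with (J.card : ZMod 2) = n,
      scalarPart (CliffordAlgebra.reverse Z * blade J) • recBlade J := by
  have hZ' := evenOdd_le_bladeSpan n hZ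
  rw [bladeSpan] at hZ'
  clear hZ
  induction hZ' using Submodule.span_induction with
  | mem X hX =>
    obtain ⟨I, hI, rfl⟩ := hX
    have hI' : (I.card : ZMod 2) = n := hI
    obtain ⟨c, hc⟩ := blade_eq_smul_recBlade I
    rw [hc, Finset.sum_congr rfl (g := fun J => if I = J then c • recBlade I else 0)]
    · simp [hI']
    · intro J hJ
      rw [map_smul, smul_mul_assoc, map_smul, scalarPart_reverse_recBlade_mul_blade
        (even_card_add_card hI' (Finset.mem_filter.1 hJ).2)]
      split_ifs with h <;> simp [h]
  | zero => simp
  | add X Y _ _ hX hY =>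
    simp only [map_add, add_mul, add_smul, Finset.sum_add_distrib]
    rw [← hX, ← hY]
  | smul r X _ hX =>
    simp only [map_smul, smul_mul_assoc, smul_assoc, ← Finset.smul_sum]
    rw [← hX]

/-! ### The Minkowski scalar product -/

lemma mdot_add_right (a b c : Form1) : mdot a (b + c) = mdot a b + mdot a c :=
  map_add (mdotBilin a) b c

lemma mdot_smul_right (r : ℝ) (a b : Form1) : mdot a (r • b) = r * mdot a b :=
  map_smul (mdotBilin a) r b

lemma mdot_neg_left (a b : Form1) : mdot (-a) b = -mdot a b := by
  simp only [← mdotBilin_apply, map_neg, LinearMap.neg_apply]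

lemma mdot_sum_left {ι : Type*} (s : Finset ι) (f : ι → Form1) (b : Form1) :
    mdot (∑ i ∈ s, f i) b = ∑ i ∈ s, mdot (f i) b := by
  simp only [← mdotBilin_apply, map_sum, LinearMap.sum_apply]

lemma mdot_sum_right {ι : Type*} (s : Finset ι) (f : ι → Form1) (a : Form1) :
    mdot a (∑ i ∈ s, f i) = ∑ i ∈ s, mdot a (f i) :=
  map_sum (mdotBilin a) f s

lemma mdot_up_left (μ : Fin 4) (b : Form1) : mdot (up μ) b = b μ := by
  simp only [up, mdot_smul_left]
  simp only [mdot, lo, Pi.single_apply, mul_ite, mul_one, mul_zero, ite_mul, zero_mul,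
    Finset.sum_ite_eq', Finset.mem_univ, if_true]
  rw [← mul_assoc, sig_mul_self, one_mul]

lemma eq_sum_lo (a : Form1) : a = ∑ μ, a μ • lo μ := pi_eq_sum_univ' a

lemma eq_sum_up (a : Form1) : a = ∑ μ, mdot a (lo μ) • up μ := by
  conv_lhs => rw [eq_sum_lo a]
  refine Finset.sum_congr rfl fun μ _ => ?_
  rw [up, smul_smul, mul_comm, ← mdot_smul_right, mdot_comm]
  exact congrArg (· • lo μ) (mdot_up_left μ a).symm

lemma eq_of_forall_mdot_eq {a b : Form1} (h : ∀ n, mdot a n = mdot b n) : a = b := by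
  rw [eq_sum_up a, eq_sum_up b]
  simp only [h]

lemma mdot_adj (t : Form1 →L[ℝ] Form1) (a b : Form1) : mdot (adj t a) b = mdot a (t b) := by
  rw [adj, mdot_sum_left]
  conv_rhs => rw [eq_sum_lo b, map_sum, mdot_sum_right]
  refine Finset.sum_congr rfl fun μ _ => ?_
  rw [mdot_smul_left, mdot_up_left, map_smul, mdot_smul_right, mul_comm]

lemma mdot_hstar (h : Form1 → Form1 →L[ℝ] Form1) (x a b : Form1) :
    mdot (hstar h x a) b = mdot a ((h x).inverse b) :=
  mdot_adj _ a b

/-- The scalar product as a continuous bilinear map. -/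
def mdotCLM : Form1 →L[ℝ] Form1 →L[ℝ] ℝ := mdotBilin.toContinuousBilinearMap

lemma mdotCLM_apply (a b : Form1) : mdotCLM a b = mdot a b := rfl

/-! ### The Levi-Civita connection -/

section Connection

variable {h : Form1 → Form1 →L[ℝ] Form1} {x : Form1}

lemma fderiv_metric (hd : DifferentiableAt ℝ h x) (a b c : Form1) :
    fderiv ℝ (fun y => metric h y b c) x a
      = mdot (fderiv ℝ h x a b) (h x c) + mdot (h x b) (fderiv ℝ h x a c) := by
  have hb : ∀ b : Form1, HasFDerivAt (fun y => h y b) ((fderiv ℝ h x).flip b) x := fun b => by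
    simpa using hd.hasFDerivAt.clm_apply (hasFDerivAt_const b x)
  have := (mdotCLM.hasFDerivAt_of_bilinear (hb b) (hb c)).fderiv
  change fderiv ℝ (fun y => mdotCLM (h y b) (h y c)) x a = _
  rw [this]
  simp [mdotCLM_apply, add_comm]

lemma christoffelLower_eq (hd : DifferentiableAt ℝ h x) (a b c : Form1) :
    christoffelLower h x a b c = (1 / 2 : ℝ) *
      (mdot (fderiv ℝ h x a b) (h x c) + mdot (h x b) (fderiv ℝ h x a c)
        + (mdot (fderiv ℝ h x b a) (h x c) + mdot (h x a) (fderiv ℝ h x b c))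
        - (mdot (fderiv ℝ h x c a) (h x b) + mdot (h x a) (fderiv ℝ h x c b))) := by
  rw [christoffelLower, fderiv_metric hd, fderiv_metric hd, fderiv_metric hd]

/-- Linearity in the last slot is not visible in the definition, where c selects a direction of
differentiation; it appears in the expanded formula. -/
lemma christoffelLower_eq_sum (hd : DifferentiableAt ℝ h x) (a b c : Form1) :
    christoffelLower h x a b c = ∑ μ, christoffelLower h x a b (lo μ) * c μ := by
  have hlin : IsLinearMap ℝ (christoffelLower h x a b) := by
    constructor
    · intro c d
      simp only [christoffelLower_eq hd, map_add, mdot_add_right, mdot_add_left,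
        add_apply]
      ring
    · intro r c
      simp only [christoffelLower_eq hd, map_smul, mdot_smul_right, mdot_smul_left, smul_eq_mul,
        smul_apply]
      ring
  have := congrArg (hlin.mk' _) (eq_sum_lo c)
  simpa only [map_sum, map_smul, smul_eq_mul, IsLinearMap.mk'_apply, mul_comm] using this

/-- Lowering with g = h†h undoes the raising with g⁻¹ = h⁻¹h^*. -/
lemma mdot_christoffel (hd : DifferentiableAt ℝ h x) (hi : (h x).IsInvertible) (a b c : Form1) :
    mdot (h x (christoffel h x a b)) (h x c) = christoffelLower h x a b c := by
  rw [christoffel, map_sum, mdot_sum_left, christoffelLower_eq_sum hd]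
  refine Finset.sum_congr rfl fun μ _ => ?_
  rw [map_smul, mdot_smul_left, hi.self_apply_inverse, mdot_hstar, hi.inverse_apply_self,
    mdot_up_left]

lemma differentiableAt_inverse (hd : DifferentiableAt ℝ h x) (hi : (h x).IsInvertible) :
    DifferentiableAt ℝ (fun y => (h y).inverse) x := by
  obtain ⟨e, he⟩ := hi
  have := (contDiffAt_map_inverse (𝕜 := ℝ) (n := 1) e).differentiableAt one_ne_zero
  rw [he] at this
  exact this.comp x hd

/-- Differentiate h(h⁻¹(n)) = n, an identity that has to hold near x and not only at x. -/
lemma fderiv_inverse_apply (hd : DifferentiableAt ℝ h x)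
    (hi : ∀ᶠ y in nhds x, (h y).IsInvertible) (n a : Form1) :
    fderiv ℝ (fun y => (h y).inverse n) x a
      = -(h x).inverse (fderiv ℝ h x a ((h x).inverse n)) := by
  have hk : DifferentiableAt ℝ (fun y => (h y).inverse n) x :=
    (differentiableAt_inverse hd hi.self_of_nhds).clm_apply (differentiableAt_const n)
  have h1 := (hd.hasFDerivAt.clm_apply hk.hasFDerivAt).fderiv
  have h2 : (fun y => h y ((h y).inverse n)) =ᶠ[nhds x] fun _ => n :=
    hi.mono fun y hy => hy.self_apply_inverse n
  rw [h2.fderiv_eq, fderiv_fun_const] at h1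
  have h3 := congrArg (fun T => (h x).inverse (T a)) h1
  simp only [Pi.zero_apply, zero_apply, map_zero, add_apply,
    ContinuousLinearMap.comp_apply, ContinuousLinearMap.flip_apply, map_add,
    hi.self_of_nhds.inverse_apply_self] at h3
  exact eq_neg_of_add_eq_zero_left h3.symm

lemma gaugeDeriv_const (hd : DifferentiableAt ℝ h x)
    (hi : ∀ᶠ y in nhds x, (h y).IsInvertible) (a n : Form1) :
    gaugeDeriv h a (fun _ => n) x
      = -fderiv ℝ h x a ((h x).inverse n) + h x (christoffel h x a ((h x).inverse n)) := by
  rw [gaugeDeriv, leviCivita, fderiv_inverse_apply hd hi, map_add, map_neg,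
    hi.self_of_nhds.self_apply_inverse]

/-- The gauge connection is compatible with the Minkowski scalar product. -/
lemma mdot_gaugeDeriv_const (hd : DifferentiableAt ℝ h x)
    (hi : ∀ᶠ y in nhds x, (h y).IsInvertible) (a m n : Form1) :
    mdot (gaugeDeriv h a (fun _ => m) x) n = -mdot m (gaugeDeriv h a (fun _ => n) x) := by
  have hx := hi.self_of_nhds
  -- With m = h(b) and n = h(c) both sides involve only lower Christoffel symbols and derivatives of
  -- h. The claim becomes Γ(a,b,c) + Γ(a,c,b) = a·∂ g(b,c).
  obtain ⟨b, rfl⟩ : ∃ b, m = h x b := ⟨_, (hx.self_apply_inverse m).symm⟩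
  obtain ⟨c, rfl⟩ : ∃ c, n = h x c := ⟨_, (hx.self_apply_inverse n).symm⟩
  rw [gaugeDeriv_const hd hi, gaugeDeriv_const hd hi, hx.inverse_apply_self, hx.inverse_apply_self,
    mdot_add_left, mdot_comm (h x b), mdot_add_left, mdot_christoffel hd hx, mdot_christoffel hd hx,
    mdot_neg_left, mdot_neg_left, christoffelLower_eq hd, christoffelLower_eq hd]
  simp only [mdot_comm (h x _)]
  ring

/-- Follows from abc - cab = a(bc + cb) - (ac + ca)b, antisymmetrised in a and b. -/
lemma commutator_wedge (a b c : Form1) :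
    wedge a b * vec c - vec c * wedge a b
      = (2 : ℝ) • vec (mdot b c • a - mdot a c • b) := by
  have h1 : ∀ a b : Form1, vec a * vec b * vec c - vec c * (vec a * vec b)
      = (2 : ℝ) • vec (mdot b c • a - mdot a c • b) := by
    intro a b
    have hac := vec_mul_vec_add_swap a c
    have hbc := vec_mul_vec_add_swap b c
    have e : vec a * vec b * vec c - vec c * (vec a * vec b)
        = vec a * (vec b * vec c + vec c * vec b) - (vec a * vec c + vec c * vec a) * vec b := by
      noncomm_ring
    rw [e, hac, hbc, ← Algebra.commutes, ← Algebra.smul_def, ← Algebra.smul_def]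
    simp only [vec, map_sub, map_smul, smul_sub, smul_smul]
  rw [wedge, smul_mul_assoc, mul_smul_comm, ← smul_sub]
  have e : (vec a * vec b - vec b * vec a) * vec c - vec c * (vec a * vec b - vec b * vec a)
      = (vec a * vec b * vec c - vec c * (vec a * vec b))
        - (vec b * vec a * vec c - vec c * (vec b * vec a)) := by
    noncomm_ring
  rw [e, h1, h1]
  simp only [vec, map_sub, map_smul]
  module

/-- The connection 2-form represents the connection: `𝒟_a n = Ω(a) × n` for constant `n`. -/
lemma commutator_Omega (hd : DifferentiableAt ℝ h x)
    (hi : ∀ᶠ y in nhds x, (h y).IsInvertible) (a n : Form1) :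
    (1 / 2 : ℝ) • (Omega h x a * vec n - vec n * Omega h x a)
      = vec (gaugeDeriv h a (fun _ => n) x) := by
  set W : Form1 → Form1 := fun n => gaugeDeriv h a (fun _ => n) x with hW
  have hanti : ∀ m n, mdot (W m) n = -mdot m (W n) := mdot_gaugeDeriv_const hd hi a
  have e1 : ∑ μ, mdot (W (lo μ)) n • up μ = -W n := by
    rw [eq_sum_up (W n), ← Finset.sum_neg_distrib]
    refine Finset.sum_congr rfl fun μ _ => ?_
    rw [hanti, mdot_comm, neg_smul]
  -- Linearity of W comes from skewness: pairing with any m moves W onto m.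
  have e2 : ∑ μ, n μ • W (lo μ) = W n := by
    refine eq_of_forall_mdot_eq fun m => ?_
    rw [mdot_sum_left, hanti]
    conv_rhs => rw [eq_sum_lo n, mdot_sum_left, ← Finset.sum_neg_distrib]
    refine Finset.sum_congr rfl fun μ _ => ?_
    rw [mdot_smul_left, mdot_smul_left, hanti, mul_neg]
  have e3 : Omega h x a * vec n - vec n * Omega h x a
      = -(1 / 2 : ℝ) • ∑ μ, (2 : ℝ) • vec (mdot (W (lo μ)) n • up μ - n μ • W (lo μ)) := by
    rw [Omega, smul_mul_assoc, mul_smul_comm, ← smul_sub, Finset.sum_mul, Finset.mul_sum,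
      ← Finset.sum_sub_distrib]
    congr 1
    refine Finset.sum_congr rfl fun μ _ => ?_
    rw [commutator_wedge, mdot_up_left]
  rw [e3, ← Finset.smul_sum]
  simp only [vec]
  rw [← map_sum, Finset.sum_sub_distrib, e1, e2, map_sub, map_neg]
  module

end Connection

/-! ### The divergence identity -/

lemma det_eq_matrix_det (T : Form1 →L[ℝ] Form1) :
    T.det = (Matrix.of fun i j => T (lo j) i).det := by
  rw [ContinuousLinearMap.det, ← LinearMap.det_toMatrix']
  rfl

lemma contDiff_det {n : WithTop ℕ∞} : ContDiff ℝ n fun T : Form1 →L[ℝ] Form1 => T.det := by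
  simp only [det_eq_matrix_det, Matrix.det_apply, Matrix.of_apply]
  refine ContDiff.sum fun σ _ => ContDiff.const_smul _ ?_
  refine contDiff_prod fun i _ => ?_
  exact contDiff_pi.1 (contDiff_id.clm_apply contDiff_const) _

lemma hasDerivAt_det_one_add_smul (E : Form1 →L[ℝ] Form1) :
    HasDerivAt (fun t : ℝ => (ContinuousLinearMap.id ℝ Form1 + t • E).det)
      (∑ μ, E (lo μ) μ) 0 := by
  set A : Matrix (Fin 4) (Fin 4) ℝ := Matrix.of fun i j => E (lo j) i with hA
  have h1 : ∀ t : ℝ, (ContinuousLinearMap.id ℝ Form1 + t • E).det = (1 + t • A).det := by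
    intro t
    rw [det_eq_matrix_det]
    congr 1
    ext i j
    simp [hA, lo, Matrix.one_apply, Pi.single_apply]
  -- The exact expansion det(1 + tA) = 1 + t tr A + t² r(t), with r a polynomial.
  have h2 : HasDerivAt (fun t : ℝ => 1 + A.trace * t
      + ((1 + (Polynomial.X : Polynomial ℝ) • A.map Polynomial.C).det.divX.divX).eval t * t ^ 2)
      (A.trace) 0 := by
    have := (((hasDerivAt_id (0 : ℝ)).const_mul A.trace).const_add 1).add
      (((1 + (Polynomial.X : Polynomial ℝ) • A.map Polynomial.C).det.divX.divX.hasDerivAt 0).mul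
        ((hasDerivAt_id (0 : ℝ)).pow 2))
    exact this.congr_deriv (by simp)
  exact h2.congr_of_eventuallyEq (.of_forall fun t => (h1 t).trans (Matrix.det_one_add_smul t A))

section Divergence

variable {h : Form1 → Form1 →L[ℝ] Form1} {x : Form1}

/-- Jacobi's formula. -/
lemma fderiv_det (hd : DifferentiableAt ℝ h x) (hi : (h x).IsInvertible) (b : Form1) :
    fderiv ℝ (fun y => (h y).det) x b
      = (h x).det * ∑ μ, (h x).inverse (fderiv ℝ h x b (lo μ)) μ := by
  have hdet : DifferentiableAt ℝ (fun T : Form1 →L[ℝ] Form1 => T.det) (h x) :=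
    contDiff_det.differentiable one_ne_zero _
  have e1 : fderiv ℝ (fun y => (h y).det) x b
      = fderiv ℝ (fun T : Form1 →L[ℝ] Form1 => T.det) (h x) (fderiv ℝ h x b) := by
    have := (hdet.hasFDerivAt.comp x hd.hasFDerivAt).fderiv
    exact congrArg (fun T => T b) this
  set B := fderiv ℝ h x b
  have hline : HasDerivAt (fun t : ℝ => h x + t • B) B 0 := by
    simpa using ((hasDerivAt_id (0 : ℝ)).smul_const B).const_add (h x)
  have hdet' : HasFDerivAt (fun T : Form1 →L[ℝ] Form1 => T.det)
      (fderiv ℝ (fun T : Form1 →L[ℝ] Form1 => T.det) (h x)) (h x + (0 : ℝ) • B) := by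
    simpa using hdet.hasFDerivAt
  have e2 := hdet'.comp_hasDerivAt 0 hline
  have e3 := (hasDerivAt_det_one_add_smul ((h x).inverse ∘L B)).const_mul (h x).det
  -- Factoring out h reduces to the derivative of the determinant at the identity.
  have e4 : (fun t : ℝ => (h x + t • B).det) = fun t : ℝ =>
      (h x).det * (ContinuousLinearMap.id ℝ Form1 + t • ((h x).inverse ∘L B)).det := by
    funext t
    have : h x + t • B = h x ∘L (ContinuousLinearMap.id ℝ Form1 + t • ((h x).inverse ∘L B)) := by
      ext1 v
      simp [hi.self_apply_inverse]
    rw [this]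
    exact LinearMap.det_comp _ _
  rw [e1]
  rw [← e4] at e3
  exact e2.unique e3

/-- The symmetry of g^{μν}: h⁻¹(h⁻¹)† is self-adjoint. -/
lemma inverse_hstar_comm (μ ν : Fin 4) :
    (h x).inverse (hstar h x (up μ)) ν = (h x).inverse (hstar h x (up ν)) μ := by
  rw [← mdot_up_left ν ((h x).inverse _), ← mdot_hstar, mdot_comm, mdot_hstar, mdot_up_left]

lemma sum_inverse_hstar_smul (hi : (h x).IsInvertible) (μ : Fin 4) :
    ∑ ν, (h x).inverse (hstar h x (up ν)) μ • h x (lo ν) = hstar h x (up μ) := by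
  simp only [inverse_hstar_comm _ μ, ← map_smul, ← map_sum]
  rw [← eq_sum_lo, hi.self_apply_inverse]

/-- The contracted Christoffel symbols are the logarithmic derivative of `det h`. -/
lemma det_mul_sum_christoffel (hd : DifferentiableAt ℝ h x) (hi : (h x).IsInvertible)
    (b : Form1) :
    (h x).det * ∑ μ, christoffel h x (lo μ) b μ = fderiv ℝ (fun y => (h y).det) x b := by
  rw [fderiv_det hd hi]
  congr 1
  set g : Fin 4 → Fin 4 → ℝ := fun μ ν => (h x).inverse (hstar h x (up ν)) μ with hg
  have hsymm : ∀ μ ν, g μ ν = g ν μ := fun μ ν => inverse_hstar_comm ν μ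
  -- Here d is ∂_μ g(b, γ_ν), and e below satisfies e_{μν} + e_{νμ} = b·∂ g_{μν}. Contraction with
  -- the symmetric g^{μν} kills d_{μν} - d_{νμ} and leaves e_{μν} g^{μν}, the trace of h⁻¹(b·∂h).
  set d : Fin 4 → Fin 4 → ℝ := fun μ ν => mdot (fderiv ℝ h x (lo μ) b) (h x (lo ν))
    + mdot (h x b) (fderiv ℝ h x (lo μ) (lo ν)) with hd'
  set e : Fin 4 → Fin 4 → ℝ := fun μ ν => mdot (fderiv ℝ h x b (lo μ)) (h x (lo ν)) with he
  have e0 : ∀ μ, christoffel h x (lo μ) b μ = ∑ ν, christoffelLower h x (lo μ) b (lo ν) * g μ ν := by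
    intro μ
    simp only [christoffel, Finset.sum_apply, Pi.smul_apply, smul_eq_mul, hg]
  have e1 : ∀ μ ν, christoffelLower h x (lo μ) b (lo ν)
      = (1 / 2 : ℝ) * (d μ ν - d ν μ + (e μ ν + e ν μ)) := by
    intro μ ν
    rw [christoffelLower_eq hd]
    simp only [hd', he, mdot_comm (h x _)]
    ring
  have swap : ∀ f : Fin 4 → Fin 4 → ℝ, ∑ μ, ∑ ν, f ν μ * g μ ν = ∑ μ, ∑ ν, f μ ν * g μ ν := by
    intro f
    rw [Finset.sum_comm]
    exact Finset.sum_congr rfl fun μ _ => Finset.sum_congr rfl fun ν _ => by rw [hsymm ν μ]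
  have e2 : ∑ μ, christoffel h x (lo μ) b μ = ∑ μ, ∑ ν, e μ ν * g μ ν := by
    simp only [e0, e1]
    have : ∀ μ ν, (1 / 2 : ℝ) * (d μ ν - d ν μ + (e μ ν + e ν μ)) * g μ ν
        = (1 / 2 : ℝ) * (d μ ν * g μ ν) - (1 / 2 : ℝ) * (d ν μ * g μ ν)
          + ((1 / 2 : ℝ) * (e μ ν * g μ ν) + (1 / 2 : ℝ) * (e ν μ * g μ ν)) := by
      intro μ ν; ring
    simp only [this, Finset.sum_add_distrib, Finset.sum_sub_distrib, ← Finset.mul_sum]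
    rw [swap d, swap e]
    ring
  rw [e2]
  refine Finset.sum_congr rfl fun μ _ => ?_
  rw [← mdot_up_left μ ((h x).inverse _), ← mdot_hstar, ← sum_inverse_hstar_smul hi μ, mdot_sum_left]
  refine Finset.sum_congr rfl fun ν _ => ?_
  rw [mdot_smul_left, mdot_comm, mul_comm]

lemma differentiableAt_det (hd : DifferentiableAt ℝ h x) :
    DifferentiableAt ℝ (fun y => (h y).det) x :=
  (contDiff_det.differentiable one_ne_zero (h x)).comp x hd

lemma differentiableAt_hstar (hd : DifferentiableAt ℝ h x) (hi : (h x).IsInvertible) (a : Form1) :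
    DifferentiableAt ℝ (fun y => hstar h y a) x := by
  have hk := differentiableAt_inverse hd hi
  simp only [hstar, adj, ← mdotCLM_apply]
  fun_prop

/-- The covariant divergence of `det(h) h^*` vanishes. -/
lemma sum_fderiv_det_smul_hstar (hd : DifferentiableAt ℝ h x)
    (hi : ∀ᶠ y in nhds x, (h y).IsInvertible) :
    ∑ μ, fderiv ℝ (fun y => (h y).det • hstar h y (up μ)) x (lo μ)
      = -((h x).det • ∑ μ, gaugeDeriv h (lo μ) (fun _ => hstar h x (up μ)) x) := by
  have hx := hi.self_of_nhds
  -- Paired with a constant n, and with v = h⁻¹(n), the claim is the classical ∂_μ(det(h) v^μ) =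
  -- det(h) D_μ v^μ. On the right the field is frozen at its value at x, so only the connection acts
  -- on it, and skewness transfers that action to n.
  refine eq_of_forall_mdot_eq fun n => ?_
  rw [mdot_neg_left, mdot_smul_left, mdot_sum_left, mdot_sum_left]
  have hk : DifferentiableAt ℝ (fun y => (h y).inverse n) x :=
    (differentiableAt_inverse hd hx).clm_apply (differentiableAt_const n)
  have e1 : ∀ μ, mdot (fderiv ℝ (fun y => (h y).det • hstar h y (up μ)) x (lo μ)) n
      = fderiv ℝ (fun y => (h y).det) x (lo μ) * (h x).inverse n μ
        + (h x).det * fderiv ℝ (fun y => (h y).inverse n) x (lo μ) μ := by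
    intro μ
    have hv : DifferentiableAt ℝ (fun y => (h y).det • hstar h y (up μ)) x :=
      (differentiableAt_det hd).smul (differentiableAt_hstar hd hx _)
    have h1 := ((mdotCLM.flip n).hasFDerivAt.comp x hv.hasFDerivAt).fderiv
    have h2 : (mdotCLM.flip n) ∘ (fun y => (h y).det • hstar h y (up μ))
        = fun y => (h y).det * (h y).inverse n μ := by
      funext y
      simp only [Function.comp, ContinuousLinearMap.flip_apply, mdotCLM_apply, mdot_smul_left,
        mdot_hstar, mdot_up_left]
    rw [h2] at h1
    have h3 := ((differentiableAt_det hd).hasFDerivAt.mul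
      ((hasFDerivAt_pi'.1 hk.hasFDerivAt) μ)).fderiv
    have h4 := congrArg (fun T => T (lo μ)) (h1.symm.trans h3)
    simp [mdotCLM_apply] at h4
    rw [h4]
    ring
  have e2 : ∀ μ, mdot (gaugeDeriv h (lo μ) (fun _ => hstar h x (up μ)) x) n
      = -(fderiv ℝ (fun y => (h y).inverse n) x (lo μ) μ
        + christoffel h x (lo μ) ((h x).inverse n) μ) := by
    intro μ
    rw [mdot_gaugeDeriv_const hd hi, mdot_hstar, mdot_up_left, gaugeDeriv,
      hx.inverse_apply_self]
    rfl
  have e3 : ∑ μ, fderiv ℝ (fun y => (h y).det) x (lo μ) * (h x).inverse n μ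
      = (h x).det * ∑ μ, christoffel h x (lo μ) ((h x).inverse n) μ := by
    rw [det_mul_sum_christoffel hd hx]
    conv_rhs => rw [eq_sum_lo ((h x).inverse n), map_sum]
    exact Finset.sum_congr rfl fun μ _ => by rw [map_smul, smul_eq_mul, mul_comm]
  simp only [e1, e2, Finset.sum_neg_distrib, Finset.sum_add_distrib, ← Finset.mul_sum, e3]
  ring

end Divergence

/-! ### The fundamental lemma of the calculus of variations -/

/-- If `∫ (F φ + ∑_μ G^μ ∂_μ φ) = 0` for all test functions `φ` on the open set `U`, then
`F = ∑_μ ∂_μ G^μ` on `U`. -/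
lemma eq_sum_fderiv_of_integral_eq_zero {U : Set Form1} (hU : IsOpen U) {F : Form1 → ℝ}
    {G : Fin 4 → Form1 → ℝ} (hF : ContinuousOn F U) (hG : ∀ μ, ContDiffOn ℝ 1 (G μ) U)
    (H : ∀ φ : Form1 → ℝ, ContDiff ℝ ∞ φ → HasCompactSupport φ → tsupport φ ⊆ U →
      ∫ x, (F x * φ x + ∑ μ, G μ x * fderiv ℝ φ x (lo μ)) = 0) :
    ∀ x ∈ U, F x = ∑ μ, fderiv ℝ (G μ) x (lo μ) := by
  have hG' : ∀ μ, ContinuousOn (fun x => fderiv ℝ (G μ) x (lo μ)) U := fun μ =>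
    ((hG μ).continuousOn_fderiv_of_isOpen hU le_rfl).clm_apply continuousOn_const
  have hcont : ContinuousOn (fun x => F x - ∑ μ, fderiv ℝ (G μ) x (lo μ)) U :=
    hF.sub (continuousOn_finsetSum _ fun μ _ => hG' μ)
  have hae : ∀ᵐ x ∂(volume : Measure Form1), x ∈ U →
      F x - ∑ μ, fderiv ℝ (G μ) x (lo μ) = 0 := by
    refine hU.ae_eq_zero_of_integral_contDiff_smul_eq_zero
      (hcont.locallyIntegrableOn hU.measurableSet) fun φ hφ hc hs => ?_
    -- F and G are controlled only on U; a factor supported inside U makes the products globally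
    -- continuous.
    have hint : ∀ f g : Form1 → ℝ, ContinuousOn f U → Continuous g → tsupport g ⊆ tsupport φ →
        Integrable (fun x => f x * g x) := by
      intro f g hf hg hgs
      have hgc : HasCompactSupport g := hc.mono' ((subset_tsupport g).trans hgs)
      have hcm : HasCompactSupport fun x => f x * g x := hgc.mul_left
      refine Continuous.integrable_of_hasCompactSupport ?_ hcm
      refine continuous_of_tsupport fun x hx => ?_
      have hxU : x ∈ U := hs (hgs (tsupport_mul_subset_right hx))
      exact (hf.continuousAt (hU.mem_nhds hxU)).mul hg.continuousAt
    have hφ' : ∀ μ, Continuous fun x => fderiv ℝ φ x (lo μ) := fun μ =>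
      (hφ.continuous_fderiv (by simp)).clm_apply continuous_const
    have hφs : ∀ μ, tsupport (fun x => fderiv ℝ φ x (lo μ)) ⊆ tsupport φ := fun μ =>
      tsupport_fderiv_apply_subset ℝ (lo μ)
    have i1 := hint F φ hF hφ.continuous subset_rfl
    have i2 := fun μ => hint (G μ) (fun x => fderiv ℝ φ x (lo μ)) (hG μ).continuousOn (hφ' μ) (hφs μ)
    have i3 := fun μ => hint (fun x => fderiv ℝ (G μ) x (lo μ)) φ (hG' μ) hφ.continuous subset_rfl
    have i4 := fun μ => hint (G μ) φ (hG μ).continuousOn hφ.continuous subset_rfl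
    have hparts : ∀ μ, ∫ x, G μ x * fderiv ℝ φ x (lo μ) = -∫ x, fderiv ℝ (G μ) x (lo μ) * φ x :=
      fun μ => integral_mul_fderiv_eq_neg_fderiv_mul_of_integrable (i3 μ) (i2 μ) (i4 μ)
        (fun x hx => ((hG μ).differentiableOn one_ne_zero).differentiableAt (hU.mem_nhds (hs hx)))
        (fun x _ => hφ.differentiable (by simp) x)
    have h0 := H φ hφ hc hs
    rw [integral_add i1 (integrable_finsetSum _ fun μ _ => i2 μ),
      integral_finsetSum _ fun μ _ => i2 μ] at h0
    simp only [hparts] at h0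
    rw [Finset.sum_neg_distrib, ← integral_finsetSum _ fun μ _ => i3 μ, ← sub_eq_add_neg,
      ← integral_sub i1 (integrable_finsetSum _ fun μ _ => i3 μ)] at h0
    rw [← h0]
    refine integral_congr_ae (.of_forall fun x => ?_)
    simp only [smul_eq_mul, ← Finset.sum_mul]
    ring
  -- Continuity on the open set upgrades almost everywhere to everywhere.
  have heq : Set.EqOn (fun x => F x - ∑ μ, fderiv ℝ (G μ) x (lo μ)) (fun _ => 0) U :=
    Measure.eqOn_open_of_ae_eq ((ae_restrict_iff' hU.measurableSet).2 hae) hU hcont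
      continuousOn_const
  exact fun x hx => sub_eq_zero.1 (heq hx)

/-! ### Smoothness of the gauge fields -/

/-- The Clifford product as a continuous bilinear map. -/
def mulCLM : STA →L[ℝ] STA →L[ℝ] STA := (LinearMap.mul ℝ STA).toContinuousBilinearMap

lemma mulCLM_apply (X Y : STA) : mulCLM X Y = X * Y := rfl

/-- The inclusion of 1-forms as a continuous linear map. -/
def vecCLM : Form1 →L[ℝ] STA := LinearMap.toContinuousLinearMap (CliffordAlgebra.ι minkQ)

lemma vecCLM_apply (a : Form1) : vecCLM a = vec a := rfl

/-- The trace form `(X, Y) ↦ ⟨X̃ Y⟩₀`. -/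
def pairCLM : STA →L[ℝ] STA →L[ℝ] ℝ :=
  (((LinearMap.mul ℝ STA).comp CliffordAlgebra.reverse).compr₂ scalarPart).toContinuousBilinearMap

lemma pairCLM_apply (X Y : STA) :
    pairCLM X Y = scalarPart (CliffordAlgebra.reverse X * Y) := rfl

section Smooth

variable {U : Set Form1} {h : Form1 → Form1 →L[ℝ] Form1}

lemma contDiffOn_inverse (hh : ContDiffOn ℝ ∞ h U) (hinv : ∀ x ∈ U, (h x).IsInvertible) :
    ContDiffOn ℝ ∞ (fun y => (h y).inverse) U := by
  intro x hx
  obtain ⟨e, he⟩ := hinv x hx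
  have := contDiffAt_map_inverse (𝕜 := ℝ) (n := ∞) e
  rw [he] at this
  exact this.comp_contDiffWithinAt x (hh x hx)

lemma contDiffOn_hstar (hh : ContDiffOn ℝ ∞ h U) (hinv : ∀ x ∈ U, (h x).IsInvertible)
    {a : Form1 → Form1} (ha : ContDiffOn ℝ ∞ a U) :
    ContDiffOn ℝ ∞ (fun y => hstar h y (a y)) U := by
  have hk := contDiffOn_inverse hh hinv
  simp only [hstar, adj, ← mdotCLM_apply]
  fun_prop

lemma contDiffOn_christoffelLower (hU : IsOpen U) (hh : ContDiffOn ℝ ∞ h U)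
    {a b c : Form1 → Form1} (ha : ContDiffOn ℝ ∞ a U) (hb : ContDiffOn ℝ ∞ b U)
    (hc : ContDiffOn ℝ ∞ c U) :
    ContDiffOn ℝ ∞ (fun y => christoffelLower h y (a y) (b y) (c y)) U := by
  have hdh : ContDiffOn ℝ ∞ (fderiv ℝ h) U := hh.fderiv_of_isOpen hU (by simp)
  have hd : ∀ x ∈ U, DifferentiableAt ℝ h x := fun x hx =>
    (hh.differentiableOn (by simp)).differentiableAt (hU.mem_nhds hx)
  refine ContDiffOn.congr ?_ fun x hx => christoffelLower_eq (hd x hx) _ _ _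
  have hm : ∀ {u v : Form1 → Form1}, ContDiffOn ℝ ∞ u U → ContDiffOn ℝ ∞ v U →
      ContDiffOn ℝ ∞ (fun y => mdot (u y) (v y)) U := fun hu hv =>
    (mdotCLM.contDiff.comp_contDiffOn hu).clm_apply hv
  have hab := (hdh.clm_apply ha).clm_apply hb
  have hac := (hdh.clm_apply ha).clm_apply hc
  have hba := (hdh.clm_apply hb).clm_apply ha
  have hbc := (hdh.clm_apply hb).clm_apply hc
  have hca := (hdh.clm_apply hc).clm_apply ha
  have hcb := (hdh.clm_apply hc).clm_apply hb
  have ha' := hh.clm_apply ha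
  have hb' := hh.clm_apply hb
  have hc' := hh.clm_apply hc
  exact contDiffOn_const.mul ((((hm hab hc').add (hm hb' hac)).add
    ((hm hba hc').add (hm ha' hbc))).sub ((hm hca hb').add (hm ha' hcb)))

lemma contDiffOn_christoffel (hU : IsOpen U) (hh : ContDiffOn ℝ ∞ h U)
    (hinv : ∀ x ∈ U, (h x).IsInvertible) {a b : Form1 → Form1} (ha : ContDiffOn ℝ ∞ a U)
    (hb : ContDiffOn ℝ ∞ b U) : ContDiffOn ℝ ∞ (fun y => christoffel h y (a y) (b y)) U := by
  refine ContDiffOn.sum fun μ _ => ?_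
  exact (contDiffOn_christoffelLower hU hh ha hb contDiffOn_const).smul
    ((contDiffOn_inverse hh hinv).clm_apply (contDiffOn_hstar hh hinv contDiffOn_const))

lemma contDiffOn_gaugeDeriv_const (hU : IsOpen U) (hh : ContDiffOn ℝ ∞ h U)
    (hinv : ∀ x ∈ U, (h x).IsInvertible) (a n : Form1) :
    ContDiffOn ℝ ∞ (gaugeDeriv h a fun _ => n) U := by
  have hdh : ContDiffOn ℝ ∞ (fderiv ℝ h) U := hh.fderiv_of_isOpen hU (by simp)
  have hd : ∀ x ∈ U, DifferentiableAt ℝ h x := fun x hx =>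
    (hh.differentiableOn (by simp)).differentiableAt (hU.mem_nhds hx)
  have hk : ContDiffOn ℝ ∞ (fun y => (h y).inverse n) U :=
    (contDiffOn_inverse hh hinv).clm_apply contDiffOn_const
  refine ContDiffOn.congr ?_ fun x hx =>
    gaugeDeriv_const (hd x hx) (Filter.eventually_of_mem (hU.mem_nhds hx) hinv) a n
  have hc := contDiffOn_christoffel hU hh hinv (contDiffOn_const (c := a)) hk
  exact ((hdh.clm_apply contDiffOn_const).clm_apply hk).neg.add (hh.clm_apply hc)

lemma contDiffOn_Omega (hU : IsOpen U) (hh : ContDiffOn ℝ ∞ h U)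
    (hinv : ∀ x ∈ U, (h x).IsInvertible) (a : Form1) :
    ContDiffOn ℝ ∞ (fun y => Omega h y a) U := by
  refine ContDiffOn.const_smul _ (ContDiffOn.sum fun μ _ => ?_)
  have hg := contDiffOn_gaugeDeriv_const hU hh hinv a (lo μ)
  simp only [wedge, ← vecCLM_apply, ← mulCLM_apply]
  fun_prop

lemma contDiffOn_spinorDeriv (hU : IsOpen U) (hh : ContDiffOn ℝ ∞ h U)
    (hinv : ∀ x ∈ U, (h x).IsInvertible) {ψ : Form1 → STA} (hψ : ContDiffOn ℝ ∞ ψ U) :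
    ContDiffOn ℝ ∞ (spinorDeriv h ψ) U := by
  refine ContDiffOn.sum fun μ _ => ?_
  have hs := contDiffOn_hstar hh hinv (contDiffOn_const (c := up μ))
  have hO := contDiffOn_Omega hU hh hinv (lo μ)
  have hdψ : ContDiffOn ℝ ∞ (fderiv ℝ ψ) U := hψ.fderiv_of_isOpen hU (by simp)
  simp only [spinorDirDeriv, ← vecCLM_apply, ← mulCLM_apply]
  fun_prop

end Smooth

/-! ### Parity and reversion -/

lemma wedge_mem_evenOdd (a b : Form1) : wedge a b ∈ evenPart :=
  Submodule.smul_mem _ _ (Submodule.sub_mem _ (CliffordAlgebra.ι_mul_ι_mem_evenOdd_zero _ _ _)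
    (CliffordAlgebra.ι_mul_ι_mem_evenOdd_zero _ _ _))

lemma Omega_mem_evenOdd (h : Form1 → Form1 →L[ℝ] Form1) (x a : Form1) : Omega h x a ∈ evenPart :=
  Submodule.smul_mem _ _ (Submodule.sum_mem _ fun _ _ => wedge_mem_evenOdd _ _)

lemma reverse_wedge (a b : Form1) : CliffordAlgebra.reverse (wedge a b) = -wedge a b := by
  simp only [wedge, map_smul, map_sub, CliffordAlgebra.reverse.map_mul, CliffordAlgebra.reverse_ι]
  rw [← smul_neg, neg_sub]

lemma reverse_Omega (h : Form1 → Form1 →L[ℝ] Form1) (x a : Form1) :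
    CliffordAlgebra.reverse (Omega h x a) = -Omega h x a := by
  simp only [Omega, map_smul, map_sum, reverse_wedge, Finset.sum_neg_distrib, smul_neg]

lemma mul_mem_evenOdd {m n k : ZMod 2} (hk : m + n = k) {X Y : STA}
    (hX : X ∈ CliffordAlgebra.evenOdd minkQ m) (hY : Y ∈ CliffordAlgebra.evenOdd minkQ n) :
    X * Y ∈ CliffordAlgebra.evenOdd minkQ k := by
  rw [← hk]
  exact CliffordAlgebra.evenOdd_mul_le minkQ m n (Submodule.mul_mem_mul hX hY)

lemma fderiv_mem_evenOdd {n : ZMod 2} {f : Form1 → STA}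
    (hf : ∀ x, f x ∈ CliffordAlgebra.evenOdd minkQ n) (x a : Form1) :
    fderiv ℝ f x a ∈ CliffordAlgebra.evenOdd minkQ n := by
  by_cases hd : DifferentiableAt ℝ f x
  -- A continuous linear map with values in the parity-n part that fixes f; differentiating f = q ∘
  -- f shows that it fixes the derivative too.
  · let q : STA →L[ℝ] STA := ∑ J : Finset (Fin 4) with (J.card : ZMod 2) = n,
      (pairCLM.flip (blade J)).smulRight (recBlade J)
    have hq : ∀ Z, q Z = ∑ J : Finset (Fin 4) with (J.card : ZMod 2) = n,
        pairCLM Z (blade J) • recBlade J := fun Z => by simp [q]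
    have h1 : f = q ∘ f := by
      funext y
      rw [Function.comp, hq]
      exact eq_sum_scalarPart_smul_recBlade (hf y)
    have h2 : fderiv ℝ f x a = q (fderiv ℝ f x a) := by
      conv_lhs => rw [h1, (q.hasFDerivAt.comp x hd.hasFDerivAt).fderiv]
      rfl
    rw [h2, hq]
    refine Submodule.sum_mem _ fun J hJ => Submodule.smul_mem _ _ ?_
    rw [← (Finset.mem_filter.1 hJ).2]
    exact recBlade_mem_evenOdd J
  · rw [fderiv_zero_of_not_differentiableAt hd]
    exact Submodule.zero_mem _

lemma spinorDeriv_mem_evenOdd {m n : ZMod 2} (hmn : 1 + m = n) (h : Form1 → Form1 →L[ℝ] Form1)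
    {f : Form1 → STA} (hf : ∀ x, f x ∈ CliffordAlgebra.evenOdd minkQ m) (x : Form1) :
    spinorDeriv h f x ∈ CliffordAlgebra.evenOdd minkQ n := by
  refine Submodule.sum_mem _ fun μ _ => ?_
  refine mul_mem_evenOdd hmn (CliffordAlgebra.ι_mem_evenOdd_one _ _) (Submodule.add_mem _ ?_ ?_)
  · exact fderiv_mem_evenOdd hf x _
  · exact Submodule.smul_mem _ _ (mul_mem_evenOdd (zero_add m) (Omega_mem_evenOdd h x _) (hf x))

lemma gradEven_mem_evenOdd (f : STA → ℝ) (X : STA) :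
    gradEven f X ∈ CliffordAlgebra.evenOdd minkQ 0 := by
  refine Submodule.sum_mem _ fun I hI => Submodule.smul_mem _ _ ?_
  rw [← ZMod.natCast_eq_zero_iff_even.2 (Finset.mem_filter.1 hI).2]
  exact recBlade_mem_evenOdd I

lemma gradOdd_mem_evenOdd (f : STA → ℝ) (Y : STA) :
    gradOdd f Y ∈ CliffordAlgebra.evenOdd minkQ 1 := by
  refine Submodule.sum_mem _ fun I hI => Submodule.smul_mem _ _ ?_
  rw [← ZMod.natCast_eq_one_iff_odd.2 (Finset.mem_filter.1 hI).2]
  exact recBlade_mem_evenOdd I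

lemma pairCLM_gradEven (f : STA → ℝ) (X : STA) {A : STA}
    (hA : A ∈ CliffordAlgebra.evenOdd minkQ 0) : pairCLM (gradEven f X) A = fderiv ℝ f X A := by
  rw [gradEven, pairCLM_apply,
    Finset.filter_congr fun I _ => (ZMod.natCast_eq_zero_iff_even (n := I.card)).symm]
  exact scalarPart_reverse_sum_mul (fderiv ℝ f X).toLinearMap hA

lemma pairCLM_gradOdd (f : STA → ℝ) (Y : STA) {A : STA}
    (hA : A ∈ CliffordAlgebra.evenOdd minkQ 1) : pairCLM (gradOdd f Y) A = fderiv ℝ f Y A := by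
  rw [gradOdd, pairCLM_apply,
    Finset.filter_congr fun I _ => (ZMod.natCast_eq_one_iff_odd (n := I.card)).symm]
  exact scalarPart_reverse_sum_mul (fderiv ℝ f Y).toLinearMap hA

lemma pairCLM_vec_mul (a : Form1) (X Y : STA) : pairCLM X (vec a * Y) = pairCLM (vec a * X) Y := by
  rw [pairCLM_apply, pairCLM_apply, CliffordAlgebra.reverse.map_mul, CliffordAlgebra.reverse_ι,
    mul_assoc]

lemma pairCLM_Omega_mul (h : Form1 → Form1 →L[ℝ] Form1) (x a : Form1) (X Y : STA) :
    pairCLM X (Omega h x a * Y) = -pairCLM (Omega h x a * X) Y := by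
  rw [pairCLM_apply, pairCLM_apply, CliffordAlgebra.reverse.map_mul, reverse_Omega, mul_neg,
    neg_mul, map_neg, neg_neg, mul_assoc]


/-! ### The variation and the Euler–Lagrange equation -/

section EulerLagrange

variable {U : Set Form1} {h : Form1 → Form1 →L[ℝ] Form1} {l : Form1 × STA × STA → ℝ}
  {x : Form1} {X Y : STA}

lemma hasFDerivAt_partial_fst (hl : DifferentiableAt ℝ l (x, X, Y)) :
    HasFDerivAt (fun Z => l (x, Z, Y)) (fderiv ℝ l (x, X, Y) ∘L
      (ContinuousLinearMap.inr ℝ Form1 (STA × STA) ∘L ContinuousLinearMap.inl ℝ STA STA)) X := by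
  have h1 : HasFDerivAt (fun Z : STA => (x, Z, Y))
      (ContinuousLinearMap.inr ℝ Form1 (STA × STA) ∘L ContinuousLinearMap.inl ℝ STA STA) X :=
    (hasFDerivAt_prodMk_right x (X, Y)).comp X (hasFDerivAt_prodMk_left X Y)
  exact hl.hasFDerivAt.comp X h1

lemma hasFDerivAt_partial_snd (hl : DifferentiableAt ℝ l (x, X, Y)) :
    HasFDerivAt (fun Z => l (x, X, Z)) (fderiv ℝ l (x, X, Y) ∘L
      (ContinuousLinearMap.inr ℝ Form1 (STA × STA) ∘L ContinuousLinearMap.inr ℝ STA STA)) Y := by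
  have h1 : HasFDerivAt (fun Z : STA => (x, X, Z))
      (ContinuousLinearMap.inr ℝ Form1 (STA × STA) ∘L ContinuousLinearMap.inr ℝ STA STA) Y :=
    (hasFDerivAt_prodMk_right x (X, Y)).comp Y (hasFDerivAt_prodMk_right X Y)
  exact hl.hasFDerivAt.comp Y h1

lemma fderiv_partial_fst (hl : DifferentiableAt ℝ l (x, X, Y)) (A : STA) :
    fderiv ℝ (fun Z => l (x, Z, Y)) X A = fderiv ℝ l (x, X, Y) (0, A, 0) := by
  rw [(hasFDerivAt_partial_fst hl).fderiv]
  rfl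

lemma fderiv_partial_snd (hl : DifferentiableAt ℝ l (x, X, Y)) (A : STA) :
    fderiv ℝ (fun Z => l (x, X, Z)) Y A = fderiv ℝ l (x, X, Y) (0, 0, A) := by
  rw [(hasFDerivAt_partial_snd hl).fderiv]
  rfl

lemma variation_eq {ψ η : Form1 → STA}
    (hl : DifferentiableAt ℝ l (x, ψ x, spinorDeriv h ψ x)) :
    variation h l ψ η x = (h x).det *
      (fderiv ℝ (fun Z => l (x, Z, spinorDeriv h ψ x)) (ψ x) (η x)
        + fderiv ℝ (fun Z => l (x, ψ x, Z)) (spinorDeriv h ψ x) (spinorDeriv h η x)) := by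
  have hline : HasDerivAt
      (fun t : ℝ => (x, ψ x + t • η x, spinorDeriv h ψ x + t • spinorDeriv h η x))
      ((0 : Form1), η x, spinorDeriv h η x) 0 := by
    have h1 : ∀ A B : STA, HasDerivAt (fun t : ℝ => A + t • B) B 0 := fun A B => by
      simpa using ((hasDerivAt_id (0 : ℝ)).smul_const B).const_add A
    exact (hasDerivAt_const 0 x).prodMk ((h1 _ _).prodMk (h1 _ _))
  have hl' : HasFDerivAt l (fderiv ℝ l (x, ψ x, spinorDeriv h ψ x))
      (x, ψ x + (0 : ℝ) • η x, spinorDeriv h ψ x + (0 : ℝ) • spinorDeriv h η x) := by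
    simpa using hl.hasFDerivAt
  have h2 := ((hl'.comp_hasDerivAt 0 hline).const_mul (h x).det).deriv
  rw [fderiv_partial_fst hl, fderiv_partial_snd hl, ← map_add]
  simp only [Prod.mk_add_mk, add_zero, zero_add]
  exact h2

/-- This is where ℓ must be C²: its odd derivative has to be differentiated once more. -/
lemma contDiffOn_gradOdd {ψ D : Form1 → STA} (hψ : ContDiffOn ℝ 1 ψ U) (hD : ContDiffOn ℝ 1 D U)
    (hl : ∀ x ∈ U, ContDiffAt ℝ 2 l (x, ψ x, D x)) :
    ContDiffOn ℝ 1 (fun y => gradOdd (fun Y => l (y, ψ y, Y)) (D y)) U := by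
  refine ContDiffOn.sum fun I _ => ?_
  have hp : ContDiffOn ℝ 1 (fun y => (y, ψ y, D y)) U := contDiffOn_id.prodMk (hψ.prodMk hD)
  have hdl : ContDiffOn ℝ 1 (fun y => fderiv ℝ l (y, ψ y, D y)) U := fun y hy =>
    ((hl y hy).fderiv_right (m := 1) (by norm_num)).comp_contDiffWithinAt y (hp y hy)
  have hc : ContDiffOn ℝ 1 (fun y => fderiv ℝ (fun Y => l (y, ψ y, Y)) (D y) (blade I)) U :=
    (hdl.clm_apply contDiffOn_const).congr fun y hy =>
      fderiv_partial_snd ((hl y hy).differentiableAt two_ne_zero) (blade I)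
  exact hc.smul contDiffOn_const

lemma continuousOn_fderiv_partial_fst {ψ D : Form1 → STA} (hψ : ContDiffOn ℝ 1 ψ U)
    (hD : ContDiffOn ℝ 1 D U) (hl : ∀ x ∈ U, ContDiffAt ℝ 2 l (x, ψ x, D x)) (A : STA) :
    ContinuousOn (fun y => fderiv ℝ (fun X => l (y, X, D y)) (ψ y) A) U := by
  have hp : ContDiffOn ℝ 1 (fun y => (y, ψ y, D y)) U := contDiffOn_id.prodMk (hψ.prodMk hD)
  have hdl : ContDiffOn ℝ 1 (fun y => fderiv ℝ l (y, ψ y, D y)) U := fun y hy =>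
    ((hl y hy).fderiv_right (m := 1) (by norm_num)).comp_contDiffWithinAt y (hp y hy)
  exact (hdl.clm_apply contDiffOn_const).continuousOn.congr fun y hy =>
    fderiv_partial_fst ((hl y hy).differentiableAt two_ne_zero) A

lemma spinorDeriv_smul_const {φ : Form1 → ℝ} (hφ : DifferentiableAt ℝ φ x) (B : STA) :
    spinorDeriv h (fun y => φ y • B) x
      = φ x • ∑ μ, (1 / 2 : ℝ) • (vec (hstar h x (up μ)) * (Omega h x (lo μ) * B))
        + ∑ μ, fderiv ℝ φ x (lo μ) • (vec (hstar h x (up μ)) * B) := by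
  rw [Finset.smul_sum, ← Finset.sum_add_distrib]
  refine Finset.sum_congr rfl fun μ _ => ?_
  rw [spinorDirDeriv, (hφ.hasFDerivAt.smul_const B).fderiv]
  simp only [ContinuousLinearMap.smulRight_apply, mul_add, mul_smul_comm]
  rw [smul_comm (1 / 2 : ℝ), add_comm]

/-- Integration by parts against a fixed multiform `B`, pointwise: the divergence of
`det(h) h^*(γ^μ) P` in terms of the gauge spinor derivative of `P`. -/
lemma sum_fderiv_pairCLM (hd : DifferentiableAt ℝ h x)
    (hi : ∀ᶠ y in nhds x, (h y).IsInvertible) {P : Form1 → STA} (hP : DifferentiableAt ℝ P x)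
    (B : STA) :
    ∑ μ, fderiv ℝ (fun y => pairCLM (vec ((h y).det • hstar h y (up μ)) * P y) B) x (lo μ)
      = (h x).det * (pairCLM (spinorDeriv h P x) B
        + ∑ μ, (1 / 2 : ℝ) * pairCLM (P x) (vec (hstar h x (up μ)) * (Omega h x (lo μ) * B))) := by
  have e1 : ∀ μ, fderiv ℝ (fun y => pairCLM (vec ((h y).det • hstar h y (up μ)) * P y) B) x (lo μ)
      = pairCLM (vec (fderiv ℝ (fun y => (h y).det • hstar h y (up μ)) x (lo μ)) * P x) B
        + (h x).det * pairCLM (vec (hstar h x (up μ)) * fderiv ℝ P x (lo μ)) B := by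
    intro μ
    have hv : DifferentiableAt ℝ (fun y => (h y).det • hstar h y (up μ)) x :=
      (differentiableAt_det hd).smul (differentiableAt_hstar hd hi.self_of_nhds _)
    have h1 := mulCLM.hasFDerivAt_of_bilinear (vecCLM.hasFDerivAt.comp x hv.hasFDerivAt)
      hP.hasFDerivAt
    have h2 := ((pairCLM.flip B).hasFDerivAt.comp x h1).fderiv
    have h3 := congrArg (fun T => T (lo μ)) h2
    simp only [Function.comp_def, ContinuousLinearMap.flip_apply, mulCLM_apply, vecCLM_apply] at h3
    rw [h3]
    simp [mulCLM_apply, vecCLM_apply, add_comm]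
  -- The derivative of the weight becomes connection terms, and these become commutators with Ω.
  have e2 : ∑ μ, pairCLM (vec (fderiv ℝ (fun y => (h y).det • hstar h y (up μ)) x (lo μ)) * P x) B
      = -((h x).det * ∑ μ, (1 / 2 : ℝ) * (pairCLM (Omega h x (lo μ) * (vec (hstar h x (up μ)) * P x)) B
        - pairCLM (vec (hstar h x (up μ)) * (Omega h x (lo μ) * P x)) B)) := by
    calc _ = pairCLM (vec (∑ μ, fderiv ℝ (fun y => (h y).det • hstar h y (up μ)) x (lo μ)) * P x) B := by
          simp only [vec, map_sum, Finset.sum_mul, sum_apply]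
      _ = pairCLM (-((h x).det • ∑ μ, (1 / 2 : ℝ) • (Omega h x (lo μ) * vec (hstar h x (up μ))
            - vec (hstar h x (up μ)) * Omega h x (lo μ))) * P x) B := by
          rw [sum_fderiv_det_smul_hstar hd hi]
          simp only [commutator_Omega hd hi]
          simp only [vec, map_neg, map_smul, map_sum]
      _ = _ := by
          simp only [neg_mul, smul_mul_assoc, Finset.sum_mul, sub_mul, map_neg, map_smul, map_sum,
            map_sub, neg_apply, smul_apply, sub_apply, sum_apply, smul_eq_mul,
            mul_assoc]
  have e3 : pairCLM (spinorDeriv h P x) B = ∑ μ, (pairCLM (vec (hstar h x (up μ)) * fderiv ℝ P x (lo μ)) B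
      + (1 / 2 : ℝ) * pairCLM (vec (hstar h x (up μ)) * (Omega h x (lo μ) * P x)) B) := by
    simp only [spinorDeriv, spinorDirDeriv, mul_add, mul_smul_comm, map_sum, map_add, map_smul,
      sum_apply, add_apply, smul_apply, smul_eq_mul]
  -- All factors are moved off B; the h^*ΩP terms then cancel and the Ωh^*P terms agree on both
  -- sides.
  simp only [e1, Finset.sum_add_distrib, e2, e3, pairCLM_vec_mul, pairCLM_Omega_mul]
  simp only [mul_neg, ← Finset.mul_sum, Finset.sum_sub_distrib, Finset.sum_neg_distrib]
  ring

end EulerLagrange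

end GaugeSpinor

end

theorem mainTheorem3 (U : Set GaugeSpinor.Form1) (hU : IsOpen U)
    (h : GaugeSpinor.Form1 → GaugeSpinor.Form1 →L[ℝ] GaugeSpinor.Form1)
    (hh : ContDiffOn ℝ ∞ h U) (hinv : ∀ x ∈ U, (h x).IsInvertible)
    (ψ : GaugeSpinor.Form1 → GaugeSpinor.STA)
    (hψ : ContDiffOn ℝ ∞ ψ U) (hψe : ∀ x ∈ U, ψ x ∈ GaugeSpinor.evenPart)
    (l : GaugeSpinor.Form1 × GaugeSpinor.STA × GaugeSpinor.STA → ℝ)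
    (hl : ∀ x ∈ U, ContDiffAt ℝ 2 l (x, ψ x, GaugeSpinor.spinorDeriv h ψ x))
    (hAP : GaugeSpinor.StationaryAction U h l ψ) :
    ∀ x ∈ U,
      GaugeSpinor.gradEven (fun X => l (x, X, GaugeSpinor.spinorDeriv h ψ x)) (ψ x)
        - GaugeSpinor.spinorDeriv h
            (fun y => GaugeSpinor.gradOdd (fun Y => l (y, ψ y, Y)) (GaugeSpinor.spinorDeriv h ψ y))
            x = 0 := by
  open GaugeSpinor in
  set D := spinorDeriv h ψ with hDdef
  set P : Form1 → STA := fun y => gradOdd (fun Y => l (y, ψ y, Y)) (D y) with hPdef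
  have hD : ContDiffOn ℝ ∞ D U := contDiffOn_spinorDeriv hU hh hinv hψ
  have hP : ContDiffOn ℝ 1 P U := contDiffOn_gradOdd (hψ.of_le (by simp)) (hD.of_le (by simp)) hl
  have hP1 : ∀ y, P y ∈ CliffordAlgebra.evenOdd minkQ 1 := fun y => gradOdd_mem_evenOdd _ _
  have hdiff : ∀ x ∈ U, DifferentiableAt ℝ h x := fun x hx =>
    (hh.differentiableOn (by simp)).differentiableAt (hU.mem_nhds hx)
  have hdet : ContDiffOn ℝ ∞ (fun y => (h y).det) U := contDiff_det.comp_contDiffOn hh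
  have hO : ∀ μ, ContDiffOn ℝ ∞ (fun y => Omega h y (lo μ)) U := fun μ =>
    contDiffOn_Omega hU hh hinv (lo μ)
  have hs : ∀ μ, ContDiffOn ℝ ∞ (fun y => hstar h y (up μ)) U := fun μ =>
    contDiffOn_hstar hh hinv contDiffOn_const
  -- the Euler–Lagrange equation paired with an even basis multiform
  have key : ∀ J : Finset (Fin 4), (J.card : ZMod 2) = 0 → ∀ x ∈ U,
      pairCLM (gradEven (fun X => l (x, X, D x)) (ψ x) - spinorDeriv h P x) (blade J) = 0 := by
    intro J hJ
    have hB : blade J ∈ CliffordAlgebra.evenOdd minkQ 0 := hJ ▸ blade_mem_evenOdd J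
    -- F and G^μ are the coefficients of φ and ∂_μφ in the variation along φ γ_J.
    let F : Form1 → ℝ := fun y => (h y).det * (fderiv ℝ (fun X => l (y, X, D y)) (ψ y) (blade J)
      + ∑ μ, (1 / 2 : ℝ) * pairCLM (P y) (vec (hstar h y (up μ)) * (Omega h y (lo μ) * blade J)))
    let G : Fin 4 → Form1 → ℝ := fun μ y =>
      pairCLM (vec ((h y).det • hstar h y (up μ)) * P y) (blade J)
    have hF : ContinuousOn F U := by
      have c1 := continuousOn_fderiv_partial_fst (hψ.of_le (by simp)) (hD.of_le (by simp)) hl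
        (blade J)
      have c2 := hP.continuousOn
      have c3 := hdet.continuousOn
      have c4 := fun μ => (hO μ).continuousOn
      have c5 := fun μ => (hs μ).continuousOn
      refine c3.mul (c1.add (continuousOn_finsetSum _ fun μ _ => continuousOn_const.mul ?_))
      have c6 : ContinuousOn (fun y => vec (hstar h y (up μ)) * (Omega h y (lo μ) * blade J)) U :=
        ((mulCLM ∘L vecCLM).continuous.comp_continuousOn (c5 μ)).clm_apply
          ((mulCLM.continuous.comp_continuousOn (c4 μ)).clm_apply continuousOn_const)
      exact (pairCLM.continuous.comp_continuousOn c2).clm_apply c6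
    have hG : ∀ μ, ContDiffOn ℝ 1 (G μ) U := by
      intro μ
      have c1 : ContDiffOn ℝ 1 (fun y => (h y).det • hstar h y (up μ)) U :=
        (hdet.smul (hs μ)).of_le (by simp)
      have c2 : ContDiffOn ℝ 1 (fun y => vec ((h y).det • hstar h y (up μ)) * P y) U :=
        ((mulCLM ∘L vecCLM).contDiff.comp_contDiffOn c1).clm_apply hP
      exact (pairCLM.flip (blade J)).contDiff.comp_contDiffOn c2
    have hEL := eq_sum_fderiv_of_integral_eq_zero hU hF hG ?_
    · intro x hx
      have h1 := hEL x hx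
      rw [sum_fderiv_pairCLM (hdiff x hx) (Filter.eventually_of_mem (hU.mem_nhds hx) hinv)
        ((hP.differentiableOn one_ne_zero).differentiableAt (hU.mem_nhds hx))] at h1
      have hne : (h x).det ≠ 0 := by
        obtain ⟨e, he⟩ := hinv x hx
        rw [← he]
        exact e.toLinearEquiv.isUnit_det'.ne_zero
      -- The same sum of Ω-terms stands on both sides and drops out next.
      have h2 := mul_left_cancel₀ hne h1
      rw [map_sub, sub_apply, pairCLM_gradEven _ _ hB, add_right_cancel h2, sub_self]
    · intro φ hφ hc hsupp
      have hη : ∀ x, φ x • blade J ∈ evenPart := fun x => Submodule.smul_mem _ _ hB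
      have hzero : ∀ x, x ∉ tsupport φ → φ x = 0 := fun x => image_eq_zero_of_notMem_tsupport
      have h0 := hAP (fun y => φ y • blade J) (hφ.smul contDiff_const) hc.smul_right hη
        fun x hx => by
          rw [hzero x fun hxs => (hU.frontier_eq ▸ hx).2 (hsupp hxs), zero_smul]
      -- Off U both φ and its derivative vanish, so the integral over the whole space is the
      -- integral over U.
      rw [← h0, ← setIntegral_eq_integral_of_forall_compl_eq_zero (s := U)]
      · refine setIntegral_congr_fun hU.measurableSet fun x hx => ?_
        have hodd : spinorDeriv h (fun y => φ y • blade J) x ∈ CliffordAlgebra.evenOdd minkQ 1 :=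
          spinorDeriv_mem_evenOdd (add_zero 1) h hη x
        simp only [F, G]
        rw [variation_eq ((hl x hx).differentiableAt two_ne_zero), ← pairCLM_gradOdd _ _ hodd,
          spinorDeriv_smul_const (hφ.differentiable (by simp) x)]
        change _ = (h x).det * (_ + pairCLM (P x) _)
        simp only [map_smul, map_add, map_sum, smul_eq_mul, smul_mul_assoc, vec, smul_apply,
          ← pairCLM_vec_mul]
        rw [← hDdef]
        simp only [mul_assoc (h x).det, ← Finset.mul_sum, mul_comm (fderiv ℝ φ x _)]
        ring
      · intro x hx
        have hxs : x ∉ tsupport φ := fun hxs => hx (hsupp hxs)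
        have h1 : fderiv ℝ φ x = 0 :=
          image_eq_zero_of_notMem_tsupport fun hxs' => hxs (tsupport_fderiv_subset ℝ hxs')
        simp [hzero x hxs, h1]
  intro x hx
  have hZ : gradEven (fun X => l (x, X, D x)) (ψ x) - spinorDeriv h P x
      ∈ CliffordAlgebra.evenOdd minkQ 0 :=
    Submodule.sub_mem _ (gradEven_mem_evenOdd _ _) (spinorDeriv_mem_evenOdd (by decide) h hP1 x)
  -- The pairings with the even γ_J are the coefficients of this even multiform.
  rw [eq_sum_scalarPart_smul_recBlade hZ]
  refine Finset.sum_eq_zero fun J hJ => ?_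
  have := key J (Finset.mem_filter.1 hJ).2 x hx
  rw [pairCLM_apply] at this
  rw [this, zero_smul]
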